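/- An interval exchange transformation (IET) on $X=[0,b)$, $0<b<\infty$, is a right continuous bijection $f\colon X\to X$ with only finitely many discontinuities and with $f'(x)=1$ at every continuity point $x$ (that is, $f$ is a local translation there); it is minimal if every orbit $\{f^k(x):k\in\mathbb Z\}$ is dense in $X$. For $0<t<b$ let $f_t\colon[0,t)\to[0,t)$ be the map induced by $f$ on $[0,t)$, i.e. $f_t(x)=f^{n(x)}(x)$ with $n(x)=\min\{n\ge1: f^n(x)\in[0,t)\}$. Call $f_t$ weakly mixing relative to $\mu$ if it preserves the restriction of $\mu$ to $[0,t)$, is ergodic for it, and has no nonconstant measurable eigenfunction: if $G\colon[0,t)\to\mathbb C$ is measurable, $\theta\in\mathbb C$ and $G\circ f_t=\theta G$ $\mu$-almost everywhere on $[0,t)$, then $G$ is $\mu$-almost everywhere constant on $[0,t)$. Theorem. Let $f$ be a minimal IET on $X=[0,b)$ and let $\mu$ be an $f$-invariant Borel probability measure on $X$ for which $f$ is ergodic. Then the set $$X_{\mathrm{wm}}(\mu)=\{0<t<b : f_t \text{ is weakly mixing relative to } \mu\}$$ is a residual subset of $X$ (it contains a countable intersection of dense open subsets of $X$) and has full $\mu$-measure: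 it is measurable with respect to the completion of $\mu$ and $\mu(X_{\mathrm{wm}}(\mu))=1$. -/

import Mathlib

open Set Filter Topology MeasureTheory

namespace IET

/-- The phase space `X = [0, b)`, with its subspace topology and Borel σ-algebra. -/
abbrev Space (b : ℝ) : Type := Set.Ico (0 : ℝ) b

/-- A bijection `f` of `[0, b)` is an interval exchange transformation if it is right continuous,
has finitely many discontinuities, and is a local translation at every continuity point
(equivalently, has derivative `1` off the finite set of discontinuities). -/
structure IsIET {b : ℝ} (f : Equiv.Perm (Space b)) : Prop where
  right_continuous : ∀ x, ContinuousWithinAt f (Set.Ici x) x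
  finite_discontinuities : {x | ¬ ContinuousAt f x}.Finite
  local_translation : ∀ x, ContinuousAt f x → ∀ᶠ y in 𝓝 x, (f y : ℝ) - y = (f x : ℝ) - x

/-- `f` is minimal if the (two-sided) orbit of every point is dense. -/
def IsMinimal {b : ℝ} (f : Equiv.Perm (Space b)) : Prop :=
  ∀ x, Dense (Set.range fun k : ℤ => (f ^ k) x)

open Classical in
/-- The map induced by `f` on `A`: a point `x` of `A` goes to `f^[n] x`, where `n ≥ 1` is least
with `f^[n] x ∈ A`. (A point that never returns is fixed, by convention.) -/
noncomputable def inducedMap {α : Type*} (f : α → α) (A : Set α) (x : A) : A :=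
  if h : ∃ n : ℕ, 1 ≤ n ∧ f^[n] (x : α) ∈ A then
    ⟨f^[Nat.find h] (x : α), (Nat.find_spec h).2⟩
  else x

/-- Weak mixing of `T` relative to a finite measure `ν`: `T` preserves `ν`, is ergodic, and every
measurable eigenfunction is constant almost everywhere.
The notion does not change when `ν` is multiplied by a positive constant. -/
structure IsWeaklyMixing {α : Type*} [MeasurableSpace α] (T : α → α) (ν : Measure α) : Prop where
  ergodic : Ergodic T ν
  eigenfunction_const : ∀ (θ : ℂ) (G : α → ℂ), Measurable G →
    (∀ᵐ x ∂ν, G (T x) = θ * G x) → ∃ c : ℂ, ∀ᵐ x ∂ν, G x = c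

/-- The subinterval `X_t = [0, t)` of `X = [0, b)`. -/
def initialInterval {b : ℝ} (t : Space b) : Set (Space b) := {x | x < t}

/-- The set of `t` with `0 < t < b` such that the map induced by `f` on `[0, t)` is weakly mixing
relative to (the restriction of) `μ`. -/
def weaklyMixingSet {b : ℝ} (f : Equiv.Perm (Space b)) (μ : Measure (Space b)) :
    Set (Space b) :=
  {t | 0 < (t : ℝ) ∧
    IsWeaklyMixing (inducedMap f (initialInterval t))
      (μ.comap (Subtype.val : initialInterval t → Space b))}

end IET

/-!
Write `X = [0, b)`. A solution `G` of `G ∘ f_t = θ G` on `[0, t)` extends, by its value at the first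
visit to `[0, t)`, to a solution `F : X → ℂ` of the cocycle equation
`F (f x) = θ ^ [x < t] * F x` on `X`. So `f_t` is weakly mixing as soon as, for every `θ`, this
equation has only constant solutions (`isWeaklyMixing_inducedMap`; ergodicity of `f_t` is the case
where `θ = 1` and `G` is an indicator function).

Consider a tower: a short interval `B` whose images `B, f B, …` up to some height are disjoint
translates of `B`. Suppose that `t` lies in one of its levels, splits that level into two parts of
comparable mass, and that the levels below and the levels above each make up a definite part of the
space. Since `F` is close in measure to a uniformly continuous function, it is nearly constant on
most of some level below and on most of some level above. Two points of the lower level that pass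
on different sides of `t` pick up the same factors on the way to the upper level, except for one
single factor `θ`. If `|F| = 1`, this gives `θ ≈ 1`; when it happens at every scale, `θ = 1`
(`eq_one_of_cocycle`), and `F` is constant by ergodicity. That `|F|` is constant, and that `|θ| = 1`
unless `F = 0`, follows since `|F|` is monotone along orbits (`ae_eq_const_of_cocycle`).

It remains to find many such `t`. If `f` has `d` discontinuities, a short interval `J` is cut by at
most `d + 2` points into blocks that travel rigidly until they return to `J`. The towers over these
blocks exhaust the space, so that one of them has mass at least `1 / (d + 3)`
(`exists_tower_subset`). The middle parts of its middle levels consist of points `t` as above; hence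
the open set `splitSet f μ c δ` of points that are split at scale `δ` has measure at least `c`,
uniformly in `δ`. A fixed power of `f` maps it into `splitSet f μ (c / 2) δ` for small `δ`. By
minimality the latter sets are then dense (`dense_splitSet`), and by ergodicity their intersection
has full measure (`ae_mem_deepSplitSet`).
-/

namespace IET

/-! ### Interval exchanges move blocks rigidly -/

variable {b : ℝ}

/-- `g` acts on `B` as a translation of the real line. -/
def IsTranslationOn (g : Space b → Space b) (B : Set (Space b)) : Prop :=
  ∀ x ∈ B, ∀ y ∈ B, (g x : ℝ) - g y = x - y

namespace IsTranslationOn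

variable {g : Space b → Space b} {B : Set (Space b)}

lemma lt_iff (h : IsTranslationOn g B) {x y : Space b} (hx : x ∈ B) (hy : y ∈ B) :
    g x < g y ↔ x < y := by
  have := h x hx y hy
  rw [← Subtype.coe_lt_coe, ← Subtype.coe_lt_coe]
  constructor <;> intro <;> linarith

lemma le_iff (h : IsTranslationOn g B) {x y : Space b} (hx : x ∈ B) (hy : y ∈ B) :
    g x ≤ g y ↔ x ≤ y := by
  rw [← not_lt, ← not_lt, h.lt_iff hy hx]

lemma exists_preimage (h : IsTranslationOn g B) (hB : B.OrdConnected) {u w s : Space b}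
    (hu : u ∈ B) (hw : w ∈ B) (hs : s ∈ Icc (g u) (g w)) : ∃ v ∈ B, g v = s := by
  have h1 := h u hu w hw
  have h2 : (g u : ℝ) ≤ s := hs.1
  have h3 : (s : ℝ) ≤ g w := hs.2
  have hv : (u : ℝ) + (s - g u) ∈ Ico 0 b :=
    ⟨by linarith [u.2.1], by linarith [w.2.2]⟩
  have hvB : (⟨_, hv⟩ : Space b) ∈ B :=
    hB.out hu hw ⟨Subtype.coe_le_coe.1 (by simpa using h2),
      Subtype.coe_le_coe.1 (by change (u : ℝ) + (s - g u) ≤ w; linarith)⟩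
  refine ⟨_, hvB, Subtype.ext ?_⟩
  have := h _ hvB u hu
  simp only at this
  linarith

lemma image_ordConnected (h : IsTranslationOn g B) (hB : B.OrdConnected) :
    (g '' B).OrdConnected := by
  refine ⟨?_⟩
  rintro _ ⟨u, hu, rfl⟩ _ ⟨w, hw, rfl⟩ s hs
  obtain ⟨v, hv, hvs⟩ := h.exists_preimage hB hu hw hs
  exact ⟨v, hv, hvs⟩

lemma image_Ioo (h : IsTranslationOn g B) (hB : B.OrdConnected) {u w : Space b}
    (hu : u ∈ B) (hw : w ∈ B) : g '' Ioo u w = Ioo (g u) (g w) := by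
  have hsub : Ioo u w ⊆ B := Ioo_subset_Icc_self.trans (hB.out hu hw)
  apply Subset.antisymm
  · rintro _ ⟨v, hv, rfl⟩
    exact ⟨(h.lt_iff hu (hsub hv)).2 hv.1, (h.lt_iff (hsub hv) hw).2 hv.2⟩
  · intro s hs
    obtain ⟨v, hv, rfl⟩ := h.exists_preimage hB hu hw (Ioo_subset_Icc_self hs)
    exact ⟨v, ⟨(h.lt_iff hu hv).1 hs.1, (h.lt_iff hv hw).1 hs.2⟩, rfl⟩

end IsTranslationOn

variable {f : Equiv.Perm (Space b)}

/-- An interval exchange is a translation on each interval that contains no discontinuity, except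
possibly its left endpoint. -/
lemma IsIET.isTranslationOn_Icc (hf : IsIET f) {u w : Space b}
    (h : ∀ s ∈ Ioc u w, ContinuousAt f s) : IsTranslationOn f (Icc u w) := by
  suffices H : ∀ y ∈ Icc u w, (f y : ℝ) - y = f u - u by
    intro x hx y hy
    linarith [H x hx, H y hy]
  intro y hy
  rcases eq_or_lt_of_le hy.1 with rfl | huy
  · rfl
  have hpre : IsPreconnected (Ioc u y) := by
    rw [← Topology.IsInducing.subtypeVal.isPreconnected_image]
    apply Set.OrdConnected.isPreconnected
    refine ⟨?_⟩
    rintro _ ⟨a, ha, rfl⟩ _ ⟨c, hc, rfl⟩ s hs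
    have hs' : s ∈ Ico 0 b := ⟨a.2.1.trans hs.1, hs.2.trans_lt c.2.2⟩
    exact ⟨⟨s, hs'⟩, ⟨lt_of_lt_of_le ha.1 (Subtype.coe_le_coe.1 hs.1),
      le_trans (Subtype.coe_le_coe.1 hs.2) hc.2⟩, rfl⟩
  have hconst : ∀ x ∈ Ioc u y, (f x : ℝ) - x = f y - y := by
    intro x hx
    refine hpre.induction₂ (fun x y : Space b => (f x : ℝ) - x = f y - y) ?_ ?_ ?_
      hx ⟨huy, le_rfl⟩
    · intro z hz
      have := hf.local_translation z (h z ⟨hz.1, hz.2.trans hy.2⟩)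
      filter_upwards [nhdsWithin_le_nhds this] with v hv
      exact hv.symm
    · intro x y z _ _ _ h1 h2
      exact h1.trans h2
    · intro x y _ _ h1
      exact h1.symm
  have hne : (𝓝[Ioc u y] u).NeBot := by
    rw [← mem_closure_iff_nhdsWithin_neBot, closure_Ioc huy.ne]
    exact ⟨le_rfl, huy.le⟩
  have hlim : Tendsto (fun x : Space b => (f x : ℝ) - x) (𝓝[Ioc u y] u)
      (𝓝 ((f u : ℝ) - u)) := by
    have h1 : ContinuousWithinAt (fun x : Space b => (f x : ℝ) - x) (Ici u) u :=
      (continuous_subtype_val.continuousAt.comp_continuousWithinAt (hf.right_continuous u)).sub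
        continuous_subtype_val.continuousWithinAt
    exact h1.mono_left (nhdsWithin_mono _ fun x hx => hx.1.le)
  refine tendsto_nhds_unique (tendsto_const_nhds.congr' ?_) hlim
  filter_upwards [self_mem_nhdsWithin] with x hx
  exact (hconst x hx).symm

/-- The *cut points* of `J` relative to `S`: the points of `J` whose orbit meets `S` before it
returns to `J`. -/
def cutPoints (f : Equiv.Perm (Space b)) (J S : Set (Space b)) : Set (Space b) :=
  {z | z ∈ J ∧ ∃ j, f^[j] z ∈ S ∧ ∀ i, 1 ≤ i → i ≤ j → f^[i] z ∉ J}

/-- Each point of `S` is responsible for at most one cut point, namely the point at which its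
backward orbit last visited `J`. -/
lemma cutPoints_finite {J S : Set (Space b)} (hS : S.Finite) : (cutPoints f J S).Finite ∧
    (cutPoints f J S).ncard ≤ S.ncard := by
  classical
  choose! j hjS hj using fun z (hz : z ∈ cutPoints f J S) => hz.2
  have hmaps : MapsTo (fun z => f^[j z] z) (cutPoints f J S) S := hjS
  have key : ∀ z ∈ cutPoints f J S, ∀ w ∈ cutPoints f J S, j z ≤ j w →
      f^[j z] z = f^[j w] w → z = w := by
    intro z hz w hw hle heq
    obtain ⟨i, hi⟩ := Nat.exists_eq_add_of_le hle
    rw [hi, Function.iterate_add_apply] at heq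
    have hzw := f.injective.iterate _ heq
    rcases Nat.eq_zero_or_pos i with rfl | hi0
    · exact hzw
    · exact absurd (hzw ▸ hz.1) (hj w hw i hi0 (by omega))
  have hinj : InjOn (fun z => f^[j z] z) (cutPoints f J S) := by
    intro z hz w hw heq
    rcases le_total (j z) (j w) with h | h
    · exact key z hz w hw h heq
    · exact (key w hw z hz h heq.symm).symm
  exact ⟨hS.of_injOn hmaps hinj, ncard_le_ncard_of_injOn _ hmaps hinj hS⟩

/-- The points at which an orbit leaving `J = [p, q)` may be torn apart: the discontinuities of `f`
and the preimages of the endpoints of `J`. -/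
def tearSet (f : Equiv.Perm (Space b)) (p q : Space b) : Set (Space b) :=
  {x | ¬ ContinuousAt f x} ∪ {f.symm p, f.symm q}

lemma IsIET.tearSet_finite (hf : IsIET f) (p q : Space b) : (tearSet f p q).Finite :=
  hf.finite_discontinuities.union (toFinite _)

lemma tearSet_ncard_le (p q : Space b) :
    (tearSet f p q).ncard ≤ {x | ¬ ContinuousAt f x}.ncard + 2 :=
  (ncard_union_le _ _).trans (Nat.add_le_add_left ((ncard_insert_le _ _).trans (by simp)) _)

/-- An interval `B ⊆ J` without cut points, except possibly its left endpoint, travels as a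
solid block until it returns to `J`. -/
lemma IsIET.block_travels (hf : IsIET f) {p q : Space b} {B : Set (Space b)}
    (hB : B.OrdConnected) (hBJ : B ⊆ Ico p q)
    (hcut : ∀ x ∈ B, ∀ y ∈ B, ∀ z ∈ Ioc x y, z ∉ cutPoints f (Ico p q) (tearSet f p q))
    (j : ℕ) {x₀ : Space b} (hx₀ : x₀ ∈ B) (hav : ∀ i, 1 ≤ i → i ≤ j → f^[i] x₀ ∉ Ico p q) :
    (∀ z ∈ B, ∀ i, 1 ≤ i → i ≤ j → f^[i] z ∉ Ico p q) ∧ IsTranslationOn (f^[j + 1]) B := by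
  -- no interior point of `B` can reach the tear set before returning
  have hS : ∀ k, (∀ z ∈ B, ∀ i, 1 ≤ i → i ≤ k → f^[i] z ∉ Ico p q) →
      ∀ x ∈ B, ∀ v ∈ B, x < v → f^[k] v ∉ tearSet f p q := by
    intro k hk x hx v hv hxv hmem
    exact hcut x hx v hv v ⟨hxv, le_rfl⟩ ⟨hBJ hv, k, hmem, hk v hv⟩
  have step : ∀ k, (∀ z ∈ B, ∀ i, 1 ≤ i → i ≤ k → f^[i] z ∉ Ico p q) →
      IsTranslationOn (f^[k]) B → IsTranslationOn (f^[k + 1]) B := by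
    intro k hk htr
    have hlt : ∀ x ∈ B, ∀ y ∈ B, x < y →
        (f^[k + 1] x : ℝ) - f^[k + 1] y = x - y := by
      intro x hx y hy hxy
      have hcont : ∀ s ∈ Ioc (f^[k] x) (f^[k] y), ContinuousAt f s := by
        intro s hs
        obtain ⟨v, hv, rfl⟩ := htr.exists_preimage hB hx hy (Ioc_subset_Icc_self hs)
        by_contra hdis
        exact hS k hk x hx v hv ((htr.lt_iff hx hv).1 hs.1) (Or.inl hdis)
      have hle := (htr.le_iff hx hy).2 hxy.le
      have := hf.isTranslationOn_Icc hcont _ (left_mem_Icc.2 hle) _ (right_mem_Icc.2 hle)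
      rw [Function.iterate_succ_apply', Function.iterate_succ_apply', this]
      exact htr x hx y hy
    intro x hx y hy
    rcases lt_trichotomy x y with h | h | h
    · exact hlt x hx y hy h
    · simp [h]
    · linarith [hlt y hy x hx h]
  induction j with
  | zero =>
    refine ⟨fun z _ i h1 h2 => by omega, step 0 (fun z _ i h1 h2 => by omega) ?_⟩
    intro x _ y _
    rfl
  | succ j ih =>
    obtain ⟨h1, h2⟩ := ih fun i hi hij => hav i hi (by omega)
    have hx₀' := hav (j + 1) (by omega) le_rfl
    have h3 : ∀ z ∈ B, f^[j + 1] z ∉ Ico p q := by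
      intro z hz hzJ
      rcases le_or_gt p (f^[j + 1] x₀) with hp | hp
      · -- the image of `x₀` lies to the right of `J`, so the block is torn at `q`
        have hq : q ≤ f^[j + 1] x₀ := by
          by_contra hlt
          exact hx₀' ⟨hp, not_le.1 hlt⟩
        obtain ⟨v, hv, hvq⟩ := h2.exists_preimage hB hz hx₀ ⟨hzJ.2.le, hq⟩
        refine hS j h1 z hz v hv ((h2.lt_iff hz hv).1 (hvq ▸ hzJ.2)) (Or.inr (Or.inr ?_))
        rw [Set.mem_singleton_iff, Equiv.eq_symm_apply, ← hvq, Function.iterate_succ_apply']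
      · -- the image of `x₀` lies to the left of `J`, so the block is torn at `p`
        obtain ⟨v, hv, hvp⟩ := h2.exists_preimage hB hx₀ hz ⟨hp.le, hzJ.1⟩
        refine hS j h1 x₀ hx₀ v hv ((h2.lt_iff hx₀ hv).1 (hvp ▸ hp)) (Or.inr (Or.inl ?_))
        rw [Equiv.eq_symm_apply, ← hvp, Function.iterate_succ_apply']
    have h4 : ∀ z ∈ B, ∀ i, 1 ≤ i → i ≤ j + 1 → f^[i] z ∉ Ico p q := by
      intro z hz i hi hij
      rcases Nat.lt_or_ge j i with h | h
      · obtain rfl : i = j + 1 := by omega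
        exact h3 z hz
      · exact h1 z hz i hi h
    exact ⟨h4, step (j + 1) h4 h2⟩

/-- `B` is the base of a tower of height `h`: its first `h` images are disjoint intervals, on each
of which the dynamics is rigid. Disjointness of the levels is expressed by saying that no point of
`B` returns to `B` before time `h`. -/
structure IsTower (f : Equiv.Perm (Space b)) (B : Set (Space b)) (h : ℕ) : Prop where
  ordConnected : B.OrdConnected
  translation : ∀ j < h, IsTranslationOn (f^[j]) B
  noReturn : ∀ x ∈ B, ∀ j, 1 ≤ j → j < h → f^[j] x ∉ B

lemma IsTower.level_disjoint {B : Set (Space b)} {h : ℕ} (hT : IsTower f B h) {i j : ℕ}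
    (hi : i < h) (hj : j < h) (hij : i ≠ j) : Disjoint (f^[i] '' B) (f^[j] '' B) := by
  wlog hlt : i < j generalizing i j
  · exact (this hj hi hij.symm (by omega)).symm
  rw [Set.disjoint_left]
  rintro _ ⟨x, hx, rfl⟩ ⟨y, hy, hxy⟩
  obtain ⟨k, rfl⟩ := Nat.exists_eq_add_of_lt hlt
  rw [add_assoc, Function.iterate_add_apply] at hxy
  exact hT.noReturn y hy (k + 1) (by omega) (by omega) (f.injective.iterate _ hxy ▸ hx)

/-! ### Invariant measures and large towers -/

variable {μ : Measure (Space b)}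



instance : StandardBorelSpace (Space b) := measurableSet_Ico.standardBorel

lemma measurableEmbedding_iterate (hf : Measurable f) (n : ℕ) : MeasurableEmbedding (f^[n]) :=
  (hf.iterate n).measurableEmbedding (f.injective.iterate n)

lemma measure_iterate_image (hf : MeasurePreserving f μ μ) (n : ℕ) (A : Set (Space b)) :
    μ (f^[n] '' A) = μ A := by
  have := (hf.iterate n).measure_preimage_emb (measurableEmbedding_iterate hf.measurable n)
    (f^[n] '' A)
  rwa [preimage_image_eq _ (f.injective.iterate n), eq_comm] at this

lemma zpow_neg_image (n : ℕ) (A : Set (Space b)) :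
    (f ^ (-(n : ℤ))) '' A = f^[n] ⁻¹' A := by
  rw [zpow_neg, zpow_natCast, Equiv.Perm.iterate_eq_pow]
  exact Equiv.image_eq_preimage_symm _ _

lemma measure_zpow_image (hf : MeasurePreserving f μ μ) (k : ℤ) (A : Set (Space b)) :
    μ ((f ^ k) '' A) = μ A := by
  obtain ⟨n, rfl | rfl⟩ := k.eq_nat_or_neg
  · rw [zpow_natCast, ← Equiv.Perm.iterate_eq_pow, measure_iterate_image hf]
  · rw [zpow_neg_image,
      (hf.iterate n).measure_preimage_emb (measurableEmbedding_iterate hf.measurable n)]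

/-- By minimality, the translates of a nonempty open set cover the whole space. -/
lemma IsMinimal.iUnion_zpow_image (hmin : IsMinimal f) {U : Set (Space b)} (hU : IsOpen U)
    (hne : U.Nonempty) : ⋃ k : ℤ, (f ^ k) '' U = univ := by
  refine eq_univ_of_forall fun x => mem_iUnion.2 ?_
  obtain ⟨_, hy, k, rfl⟩ := (hmin x).inter_open_nonempty U hU hne
  refine ⟨-k, _, hy, ?_⟩
  simp

lemma IsMinimal.measure_pos (hmin : IsMinimal f) [IsProbabilityMeasure μ]
    (hf : MeasurePreserving f μ μ) {U : Set (Space b)} (hU : IsOpen U) (hne : U.Nonempty) :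
    0 < μ U := by
  by_contra h0
  have h0 : μ U = 0 := by simpa using h0
  have : μ (⋃ k : ℤ, (f ^ k) '' U) = 0 :=
    measure_iUnion_null fun k => by rw [measure_zpow_image hf, h0]
  rw [hmin.iUnion_zpow_image hU hne] at this
  simp at this

/-- An atom would recur, hence be periodic, and its finite orbit would not be dense. -/
lemma IsMinimal.noAtoms (hb : 0 < b) (hmin : IsMinimal f) [IsProbabilityMeasure μ]
    (hf : MeasurePreserving f μ μ) : NullSingletonClass μ := by
  refine ⟨fun x => ?_⟩
  by_contra h0
  obtain ⟨y, rfl, m, hm, hper⟩ := hf.exists_mem_iterate_mem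
    (MeasurableSet.singleton x).nullMeasurableSet h0
  have hper : (f ^ (m : ℤ)) y = y := by
    rw [zpow_natCast, ← Equiv.Perm.iterate_eq_pow]
    exact hper
  have hfin : (range fun k : ℤ => (f ^ k) y).Finite := by
    refine ((finite_Ico (0 : ℤ) m).image fun k => (f ^ k) y).subset ?_
    rintro _ ⟨k, rfl⟩
    have hm' : (0 : ℤ) < m := by omega
    refine ⟨k % m, ⟨Int.emod_nonneg _ hm'.ne', Int.emod_lt_of_pos _ hm'⟩, ?_⟩
    have hfix : ∀ i : ℤ, ((f ^ (m : ℤ)) ^ i) y = y := fun i =>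
      Function.IsFixedPt.perm_zpow hper i
    conv_rhs => rw [← Int.emod_add_mul_ediv k m]
    simp only [zpow_add, zpow_mul, Equiv.Perm.mul_apply, hfix]
  have huniv : (univ : Set (Space b)).Finite := by
    rw [← (hmin y).closure_eq, hfin.isClosed.closure_eq]
    exact hfin
  have := (Ico_infinite hb).to_subtype
  exact Set.infinite_univ huniv

/-- Almost every backward orbit visits a given set of positive measure. -/
lemma ae_exists_iterate_eq [IsProbabilityMeasure μ] (hμ : Ergodic f μ) {J : Set (Space b)}
    (hJ : MeasurableSet J) (hpos : μ J ≠ 0) : ∀ᵐ x ∂μ, ∃ k, ∃ z ∈ J, f^[k] z = x := by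
  have hmeas : MeasurableSet (⋃ k, f^[k] '' J) := MeasurableSet.iUnion fun k =>
    (measurableEmbedding_iterate hμ.measurable k).measurableSet_image.2 hJ
  have hle : (⋃ k, f^[k] '' J) ≤ᵐ[μ] f ⁻¹' (⋃ k, f^[k] '' J) := by
    refine LE.le.eventuallyLE ?_
    intro x hx
    obtain ⟨k, z, hz, rfl⟩ := mem_iUnion.1 hx
    exact mem_iUnion.2 ⟨k + 1, z, hz, Function.iterate_succ_apply' _ _ _⟩
  rcases hμ.ae_empty_or_univ_of_ae_le_preimage' hmeas.nullMeasurableSet hle (measure_ne_top _ _)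
    with h | h
  · refine absurd (measure_mono_null ?_ (ae_eq_empty.1 h)) hpos
    exact fun z hz => mem_iUnion.2 ⟨0, z, hz, rfl⟩
  · filter_upwards [eventuallyEq_univ.1 h] with x hx
    simpa using hx

/-- Almost every forward orbit visits a given set of positive measure. -/
lemma ae_exists_iterate_mem [IsProbabilityMeasure μ] (hμ : Ergodic f μ) {J : Set (Space b)}
    (hJ : MeasurableSet J) (hpos : μ J ≠ 0) : ∀ᵐ x ∂μ, ∃ k, f^[k] x ∈ J := by
  have hmeas : MeasurableSet (⋃ k, f^[k] ⁻¹' J) := MeasurableSet.iUnion fun k =>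
    hμ.measurable.iterate k hJ
  have hle : f ⁻¹' (⋃ k, f^[k] ⁻¹' J) ≤ᵐ[μ] ⋃ k, f^[k] ⁻¹' J := by
    refine LE.le.eventuallyLE ?_
    intro x hx
    obtain ⟨k, hk⟩ := mem_iUnion.1 (mem_preimage.1 hx)
    exact mem_iUnion.2 ⟨k + 1, hk⟩
  rcases hμ.ae_empty_or_univ_of_preimage_ae_le' hmeas.nullMeasurableSet hle (measure_ne_top _ _)
    with h | h
  · refine absurd (measure_mono_null ?_ (ae_eq_empty.1 h)) hpos
    exact fun z hz => mem_iUnion.2 ⟨0, hz⟩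
  · filter_upwards [eventuallyEq_univ.1 h] with x hx
    simpa using hx

/-- Cutting `J = [p, q)` at its cut points yields boundedly many blocks, whose towers exhaust the
space; one of them is therefore large. -/
lemma exists_tower_subset (hf : IsIET f) [IsProbabilityMeasure μ] (hμ : Ergodic f μ)
    {p q : Space b} (hpos : μ (Ico p q) ≠ 0) :
    ∃ B h, IsTower f B h ∧ B ⊆ Ico p q ∧
      1 / (({x | ¬ ContinuousAt f x}.ncard : ℝ) + 3) ≤ h * μ.real B := by
  classical
  set N := {x | ¬ ContinuousAt f x}.ncard + 2 with hN
  set C := cutPoints f (Ico p q) (tearSet f p q)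
  have hCfin : C.Finite := (cutPoints_finite (hf.tearSet_finite p q)).1
  have hCcard : C.ncard ≤ N :=
    (cutPoints_finite (hf.tearSet_finite p q)).2.trans (tearSet_ncard_le p q)
  -- the blocks are the level sets of the number of cut points to the left
  let φ : Space b → ℕ := fun x => (C ∩ Iic x).ncard
  have hφmono : Monotone φ := fun x y hxy =>
    ncard_le_ncard (inter_subset_inter_right _ (Iic_subset_Iic.2 hxy)) (hCfin.inter_of_left _)
  have hφN : ∀ x, φ x < N + 1 := fun x =>
    Nat.lt_succ_of_le ((ncard_le_ncard inter_subset_left hCfin).trans hCcard)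
  let B : ℕ → Set (Space b) := fun i => {x | x ∈ Ico p q ∧ φ x = i}
  have hBord : ∀ i, (B i).OrdConnected := by
    refine fun i => ⟨fun x hx y hy z hz => ⟨⟨hx.1.1.trans hz.1, hz.2.trans_lt hy.1.2⟩, ?_⟩⟩
    exact le_antisymm (hy.2 ▸ hφmono hz.2) (hx.2 ▸ hφmono hz.1)
  have hBcut : ∀ i, ∀ x ∈ B i, ∀ y ∈ B i, ∀ z ∈ Ioc x y, z ∉ C := by
    intro i x hx y hy z hz hzC
    have hlt : φ x < φ y := by
      refine ncard_lt_ncard ?_ (hCfin.inter_of_left _)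
      refine ⟨inter_subset_inter_right _ (Iic_subset_Iic.2 (hz.1.le.trans hz.2)), fun hsub => ?_⟩
      exact absurd (hsub ⟨hzC, hz.2⟩).2 (not_le.2 hz.1)
    rw [hx.2, hy.2] at hlt
    exact lt_irrefl _ hlt
  -- `T i` consists of the points whose last visit to `J` took place in the block `B i`
  let T : ℕ → Set (Space b) := fun i =>
    {x | ∃ z ∈ B i, ∃ j, f^[j] z = x ∧ ∀ i, 1 ≤ i → i ≤ j → f^[i] z ∉ Ico p q}
  have hcover : ∀ᵐ x ∂μ, x ∈ ⋃ i ∈ Finset.range (N + 1), T i := by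
    filter_upwards [ae_exists_iterate_eq hμ measurableSet_Ico hpos] with x hx
    obtain ⟨z, hz, hzx⟩ := Nat.find_spec hx
    refine mem_biUnion (x := φ z) (by simpa using hφN z) ⟨z, ⟨hz, rfl⟩, Nat.find hx, hzx, ?_⟩
    intro i hi hij hmem
    refine Nat.find_min hx (m := Nat.find hx - i) (by omega) ⟨_, hmem, ?_⟩
    rw [← Function.iterate_add_apply, Nat.sub_add_cancel hij, hzx]
  have hbig : ∃ i ∈ Finset.range (N + 1), 1 / ((N : ℝ) + 1) ≤ μ.real (T i) := by
    by_contra! hsmall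
    have h1 : (1 : ℝ) ≤ ∑ i ∈ Finset.range (N + 1), μ.real (T i) := by
      have h2 : μ.real (⋃ i ∈ Finset.range (N + 1), T i) = 1 := by
        have h3 : (⋃ i ∈ Finset.range (N + 1), T i) =ᵐ[μ] univ := eventuallyEq_univ.2 hcover
        rw [measureReal_def, measure_congr h3]
        simp
      rw [← h2]
      exact measureReal_biUnion_finset_le _ _
    have h2 := Finset.sum_lt_sum_of_nonempty (by simp) hsmall
    rw [Finset.sum_const, Finset.card_range, nsmul_eq_mul] at h2
    push_cast at h2
    rw [mul_one_div_cancel (by positivity)] at h2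
    linarith
  obtain ⟨i, -, hi⟩ := hbig
  have hTpos : 0 < μ.real (T i) := lt_of_lt_of_le (by positivity) hi
  have hBpos : μ (B i) ≠ 0 := by
    intro h0
    have : μ (T i) = 0 := by
      refine measure_mono_null (t := ⋃ j, f^[j] '' B i) ?_ (measure_iUnion_null fun j => ?_)
      · rintro x ⟨z, hz, j, hj, -⟩
        exact mem_iUnion.2 ⟨j, z, hz, hj⟩
      · rw [measure_iterate_image hμ.toMeasurePreserving, h0]
    rw [measureReal_def, this] at hTpos
    simp at hTpos
  obtain ⟨x₀, hx₀, m, hm, hret⟩ := hμ.toMeasurePreserving.exists_mem_iterate_mem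
    (hBord i).measurableSet.nullMeasurableSet hBpos
  have hex : ∃ r, 1 ≤ r ∧ f^[r] x₀ ∈ Ico p q := ⟨m, by omega, hret.1⟩
  set r := Nat.find hex with hr
  obtain ⟨hr1, hrJ⟩ := Nat.find_spec hex
  have hmin : ∀ k, 1 ≤ k → k < r → f^[k] x₀ ∉ Ico p q := fun k hk hkr hmem =>
    Nat.find_min hex hkr ⟨hk, hmem⟩
  have hblock : ∀ j < r, _ := fun j hj => hf.block_travels (hBord i) (fun x hx => hx.1) (hBcut i)
    j hx₀ fun k hk hkj => hmin k hk (by omega)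
  refine ⟨B i, r, ⟨hBord i, ?_, ?_⟩, fun x hx => hx.1, ?_⟩
  · rintro (_ | j) hj
    · intro x _ y _
      rfl
    · exact (hblock j (by omega)).2
  · intro x hx j hj hjr hmem
    exact (hblock j hjr).1 x hx j hj le_rfl hmem.1
  · have hsub : T i ⊆ ⋃ j ∈ Finset.range r, f^[j] '' B i := by
      rintro x ⟨z, hz, j, hj, hav⟩
      refine mem_biUnion (x := j) ?_ ⟨z, hz, hj⟩
      simp only [Finset.coe_range, mem_Iio]
      by_contra! hrj
      refine (hf.block_travels (hBord i) (fun x hx => hx.1) (hBcut i) j hz hav).1 x₀ hx₀ r hr1 hrj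
        hrJ
    calc 1 / (({x | ¬ ContinuousAt f x}.ncard : ℝ) + 3) = 1 / ((N : ℝ) + 1) := by
          rw [hN]; push_cast; ring_nf
      _ ≤ μ.real (T i) := hi
      _ ≤ μ.real (⋃ j ∈ Finset.range r, f^[j] '' B i) := measureReal_mono hsub (measure_ne_top _ _)
      _ ≤ ∑ j ∈ Finset.range r, μ.real (f^[j] '' B i) := measureReal_biUnion_finset_le _ _
      _ = r * μ.real (B i) := by
          simp [measureReal_def, measure_iterate_image hμ.toMeasurePreserving]

/-! ### Points that split towers at every scale -/

/-- A nonatomic measure on an interval takes all intermediate values on initial segments. -/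
lemma exists_measureReal_inter_Iio_eq [IsFiniteMeasure μ] [NullSingletonClass μ]
    {B : Set (Space b)} (hB : B.OrdConnected) {r : ℝ} (hr0 : 0 < r) (hr : r < μ.real B) :
    ∃ q ∈ B, μ.real (B ∩ Iio q) = r := by
  have hBm : MeasurableSet B := hB.measurableSet
  have hb : 0 < b := by
    by_contra hb
    have : IsEmpty (Space b) := ⟨fun x => hb (x.2.1.trans_lt x.2.2)⟩
    rw [Measure.eq_zero_of_isEmpty μ] at hr
    simp at hr
    linarith
  let ν : Measure ℝ := (μ.restrict B).map Subtype.val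
  have hval : Measurable (Subtype.val : Space b → ℝ) := measurable_subtype_coe
  have : NullSingletonClass ν := by
    refine ⟨fun x => ?_⟩
    rw [Measure.map_apply hval (MeasurableSet.singleton x)]
    have hs : (Subtype.val ⁻¹' {x} : Set (Space b)).Subsingleton :=
      fun y hy z hz => Subtype.ext (hy.trans hz.symm)
    exact hs.measure_zero _
  have : IsFiniteMeasure ν := by infer_instance
  let z : Space b := ⟨0, le_rfl, hb⟩
  have hG : ∀ s, 0 ≤ s → ∫ _ in (0 : ℝ)..s, (1 : ℝ) ∂ν = μ.real (B ∩ {x | (x : ℝ) < s}) := by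
    intro s hs
    have h1 : (fun x : Space b => (x : ℝ)) ⁻¹' Ioc 0 s =ᵐ[μ.restrict B] {x | (x : ℝ) < s} := by
      have h2 : ∀ y : ℝ, ∀ᵐ x : Space b ∂(μ.restrict B), (x : ℝ) ≠ y := by
        intro y
        have hs : {x : Space b | (x : ℝ) = y}.Subsingleton :=
          fun u hu v hv => Subtype.ext (Eq.trans hu (Eq.symm hv))
        filter_upwards [measure_eq_zero_iff_ae_notMem.1 (hs.measure_zero (μ.restrict B))] with x hx
        exact hx
      filter_upwards [h2 0, h2 s] with x hx0 hxs
      have hx0' : 0 < (x : ℝ) := lt_of_le_of_ne x.2.1 hx0.symm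
      have : (x ∈ (fun x : Space b => (x : ℝ)) ⁻¹' Ioc 0 s) ↔ (x ∈ {x : Space b | (x : ℝ) < s}) :=
        ⟨fun h => lt_of_le_of_ne h.2 hxs, fun h => ⟨hx0', le_of_lt h⟩⟩
      exact propext this
    rw [intervalIntegral.integral_of_le hs]
    simp only [integral_const, smul_eq_mul, mul_one, measureReal_restrict_apply_univ]
    rw [measureReal_def, Measure.map_apply hval measurableSet_Ioc, measure_congr h1,
      Measure.restrict_apply (measurableSet_lt hval measurable_const), inter_comm]
    rfl
  have hcont : Continuous fun s => ∫ _ in (0 : ℝ)..s, (1 : ℝ) ∂ν :=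
    intervalIntegral.continuous_primitive (fun _ _ => intervalIntegrable_const) 0
  have hGb : ∫ _ in (0 : ℝ)..b, (1 : ℝ) ∂ν = μ.real B := by
    rw [hG b hb.le]
    congr 1
    exact inter_eq_left.2 fun x _ => x.2.2
  obtain ⟨s, hs, hsr⟩ := intermediate_value_Icc hb.le hcont.continuousOn
    (show r ∈ Icc _ _ from ⟨by simpa using hr0.le, by rw [hGb]; exact hr.le⟩)
  simp only at hsr
  have hsb : s < b := by
    refine lt_of_le_of_ne hs.2 ?_
    rintro rfl
    rw [hGb] at hsr
    exact hr.ne hsr.symm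
  rw [hG s hs.1] at hsr
  refine ⟨⟨s, hs.1, hsb⟩, ?_, hsr⟩
  -- otherwise `B` lies entirely on one side of `s`
  by_contra hsB
  have hside : B ⊆ {x | (x : ℝ) < s} ∨ B ∩ {x | (x : ℝ) < s} = ∅ := by
    by_contra! hcon
    obtain ⟨hcon1, y, hyB, hys⟩ := hcon
    obtain ⟨w, hwB, hws⟩ := not_subset.1 hcon1
    exact hsB (hB.out hyB hwB ⟨Subtype.coe_le_coe.1 (le_of_lt hys),
      Subtype.coe_le_coe.1 (not_lt.1 hws)⟩)
  rcases hside with h | h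
  · rw [inter_eq_left.2 h] at hsr
    exact hr.ne hsr.symm
  · rw [h] at hsr
    simp at hsr
    exact hr0.ne hsr

/-- The points `t` that split, at scale `δ` and with definite proportion `c`, some level of a tower:
the level has at least the fraction `c` of its mass on either side of `t`, and the parts of the
tower below and above the level each have mass at least `c`. The `l` levels below and the `a` levels
above that of `t` are the witnesses; the points `q₁ < q₂` keep `t` away from the ends of its level
in a way that makes the set open. -/
def splitSet (f : Equiv.Perm (Space b)) (μ : Measure (Space b)) (c δ : ℝ) : Set (Space b) :=
  {t | ∃ (B : Set (Space b)) (l a : ℕ) (q₁ q₂ : Space b), IsTower f B (l + 1 + a) ∧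
    (∀ x ∈ B, ∀ y ∈ B, |(x : ℝ) - y| ≤ δ) ∧ 0 < μ.real B ∧ μ.real B ≤ δ ∧
    c ≤ l * μ.real B ∧ c ≤ a * μ.real B ∧ q₁ ∈ B ∧ q₂ ∈ B ∧
    c * μ.real B ≤ μ.real (B ∩ Iio q₁) ∧ c * μ.real B ≤ μ.real (B ∩ Ici q₂) ∧
    t ∈ f^[l] '' Ioo q₁ q₂}

lemma isOpen_splitSet (c δ : ℝ) : IsOpen (splitSet f μ c δ) := by
  rw [isOpen_iff_mem_nhds]
  rintro t ⟨B, l, a, q₁, q₂, hT, h1, h2, h3, h4, h5, hq₁, hq₂, h6, h7, ht⟩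
  have hopen : IsOpen (f^[l] '' Ioo q₁ q₂) := by
    rw [(hT.translation l (by omega)).image_Ioo hT.ordConnected hq₁ hq₂]
    exact isOpen_Ioo
  filter_upwards [hopen.mem_nhds ht] with s hs
  exact ⟨B, l, a, q₁, q₂, hT, h1, h2, h3, h4, h5, hq₁, hq₂, h6, h7, hs⟩

lemma splitSet_mono_right {c δ δ' : ℝ} (h : δ ≤ δ') : splitSet f μ c δ ⊆ splitSet f μ c δ' := by
  rintro t ⟨B, l, a, q₁, q₂, hT, h1, h2, h3, h4⟩
  exact ⟨B, l, a, q₁, q₂, hT, fun x hx y hy => (h1 x hx y hy).trans h, h2, h3.trans h, h4⟩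

/-- Moving `t` by a bounded power of `f` moves it to another level of the same tower. -/
lemma zpow_mem_splitSet {c δ : ℝ} (hc : 0 < c) {k : ℤ} (hk : |(k : ℝ)| * δ ≤ c / 2)
    {t : Space b} (ht : t ∈ splitSet f μ c δ) : (f ^ k) t ∈ splitSet f μ (c / 2) δ := by
  obtain ⟨B, l, a, q₁, q₂, hT, h1, h2, h3, h4, h5, hq₁, hq₂, h6, h7, z, hz, rfl⟩ := ht
  have h6' : c / 2 * μ.real B ≤ μ.real (B ∩ Iio q₁) := by nlinarith
  have h7' : c / 2 * μ.real B ≤ μ.real (B ∩ Ici q₂) := by nlinarith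
  have hkB : |(k : ℝ)| * μ.real B ≤ c / 2 :=
    (mul_le_mul_of_nonneg_left h3 (abs_nonneg _)).trans hk
  obtain ⟨n, rfl | rfl⟩ := k.eq_nat_or_neg
  · rw [zpow_natCast, ← Equiv.Perm.iterate_eq_pow]
    have hn : (n : ℝ) * μ.real B ≤ c / 2 := by simpa using hkB
    have hna : n ≤ a := by
      have : (n : ℝ) < a := lt_of_mul_lt_mul_right (by linarith) h2.le
      exact_mod_cast this.le
    obtain ⟨a, rfl⟩ := Nat.exists_eq_add_of_le hna
    push_cast at h5
    refine ⟨B, n + l, a, q₁, q₂, ?_, h1, h2, h3, ?_, by linarith, hq₁, hq₂, h6', h7', z, hz,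
      Function.iterate_add_apply _ _ _ _⟩
    · convert hT using 1
      omega
    · have : (0 : ℝ) ≤ n * μ.real B := by positivity
      push_cast
      linarith
  · have hn : (n : ℝ) * μ.real B ≤ c / 2 := by simpa using hkB
    have hnl : n ≤ l := by
      have : (n : ℝ) < l := lt_of_mul_lt_mul_right (by linarith) h2.le
      exact_mod_cast this.le
    obtain ⟨l, rfl⟩ := Nat.exists_eq_add_of_le hnl
    push_cast at h4
    refine ⟨B, l, n + a, q₁, q₂, ?_, h1, h2, h3, by linarith, ?_, hq₁, hq₂, h6', h7', z, hz, ?_⟩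
    · convert hT using 1
      omega
    · have : (0 : ℝ) ≤ n * μ.real B := by positivity
      push_cast
      linarith
    · rw [Function.iterate_add_apply, zpow_neg, zpow_natCast,
        Equiv.Perm.iterate_eq_pow f n]
      exact (Equiv.symm_apply_apply (f ^ n) _).symm

/-- There are arbitrarily short intervals of arbitrarily small positive measure. -/
lemma exists_Ico_small (hb : 0 < b) (hmin : IsMinimal f) [IsProbabilityMeasure μ]
    (hf : MeasurePreserving f μ μ) {ε : ℝ} (hε : 0 < ε) :
    ∃ p q : Space b, μ (Ico p q) ≠ 0 ∧ μ.real (Ico p q) ≤ ε ∧ (q : ℝ) - p ≤ ε := by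
  have := hmin.noAtoms hb hf
  let z : Space b := ⟨0, le_rfl, hb⟩
  obtain ⟨U, hzU, hU, hUε⟩ := Set.exists_isOpen_lt_of_lt {z} (ENNReal.ofReal ε)
    (by simpa using hε) (μ := μ)
  obtain ⟨r, hr, hrU⟩ := Metric.isOpen_iff.1 hU z (hzU rfl)
  set s := min (min (r / 2) ε) (b / 2) with hs
  have hs0 : 0 < s := by positivity
  have hsb : s < b := (min_le_right _ _).trans_lt (by linarith)
  have hsr : s < r := ((min_le_left _ _).trans (min_le_left _ _)).trans_lt (by linarith)
  have hsε : s ≤ ε := (min_le_left _ _).trans (min_le_right _ _)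
  refine ⟨z, ⟨s, hs0.le, hsb⟩, ?_, ?_, by simpa [z] using hsε⟩
  · have hne : (Ioo z ⟨s, hs0.le, hsb⟩).Nonempty :=
      ⟨⟨s / 2, by linarith, by linarith⟩, Subtype.coe_lt_coe.1 (show (0 : ℝ) < s / 2 by linarith),
        Subtype.coe_lt_coe.1 (show s / 2 < s by linarith)⟩
    exact ((hmin.measure_pos hf isOpen_Ioo hne).trans_le (measure_mono Ioo_subset_Ico_self)).ne'
  · have hsub : Ico z ⟨s, hs0.le, hsb⟩ ⊆ U := by
      intro x hx
      refine hrU ?_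
      have h1 : (x : ℝ) < s := hx.2
      rw [Metric.mem_ball, Subtype.dist_eq, Real.dist_eq]
      simp only [z, sub_zero]
      rw [abs_of_nonneg x.2.1]
      linarith
    rw [measureReal_def]
    exact ENNReal.toReal_le_of_le_ofReal hε.le ((measure_mono hsub).trans hUε.le)

/-- At every scale the split points have measure bounded below: they contain the middle portions of
the middle levels of a large tower. -/
lemma exists_le_measureReal_splitSet (hb : 0 < b) (hf : IsIET f) (hmin : IsMinimal f)
    [IsProbabilityMeasure μ] (hμ : Ergodic f μ) :
    ∃ c > 0, ∀ δ > 0, c ≤ μ.real (splitSet f μ c δ) := by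
  have := hmin.noAtoms hb hμ.toMeasurePreserving
  set c₀ : ℝ := 1 / (({x | ¬ ContinuousAt f x}.ncard : ℝ) + 3) with hc₀
  have hc₀pos : 0 < c₀ := by positivity
  have hc₀le : c₀ ≤ 1 / 3 := by
    rw [hc₀]
    exact one_div_le_one_div_of_le (by norm_num) (by
      have : (0 : ℝ) ≤ {x | ¬ ContinuousAt f x}.ncard := by positivity
      linarith)
  refine ⟨c₀ / 24, by positivity, fun δ hδ => ?_⟩
  obtain ⟨p, q, hpos, hsmall, hlen⟩ := exists_Ico_small hb hmin hμ.toMeasurePreserving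
    (ε := min δ (c₀ / 100)) (by positivity)
  obtain ⟨B, h, hT, hBJ, hlarge⟩ := exists_tower_subset hf hμ hpos
  rw [← hc₀] at hlarge
  set m := μ.real B with hm
  have hmε : m ≤ min δ (c₀ / 100) := (measureReal_mono hBJ (measure_ne_top _ _)).trans hsmall
  have hmδ : m ≤ δ := hmε.trans (min_le_left _ _)
  have hmc : m ≤ c₀ / 100 := hmε.trans (min_le_right _ _)
  have hm0 : 0 < m := by
    rcases (measureReal_nonneg : 0 ≤ μ.real B).eq_or_lt with h0 | h0
    · rw [hm, ← h0] at hlarge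
      simp at hlarge
      linarith
    · exact h0
  obtain ⟨q₁, hq₁, hq₁m⟩ := exists_measureReal_inter_Iio_eq hT.ordConnected
    (show 0 < m / 3 by positivity) (show m / 3 < μ.real B by linarith)
  obtain ⟨q₂, hq₂, hq₂m⟩ := exists_measureReal_inter_Iio_eq hT.ordConnected
    (show 0 < 2 * m / 3 by positivity) (show 2 * m / 3 < μ.real B by linarith)
  have hBm : MeasurableSet B := hT.ordConnected.measurableSet
  have hq₂m' : μ.real (B ∩ Ici q₂) = m / 3 := by
    have h1 := measureReal_inter_add_sdiff (μ := μ) (s := B) (measurableSet_Iio (a := q₂))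
    have h2 : B \ Iio q₂ = B ∩ Ici q₂ := by
      ext x
      simp
    rw [h2] at h1
    linarith
  have hIoo : m / 3 ≤ μ.real (Ioo q₁ q₂) := by
    have hsub : B ∩ Iio q₂ ⊆ (B ∩ Iio q₁) ∪ ({q₁} ∪ Ioo q₁ q₂) := by
      rintro x ⟨hx, hx2⟩
      rcases lt_trichotomy x q₁ with h | h | h
      · exact Or.inl ⟨hx, h⟩
      · exact Or.inr (Or.inl h)
      · exact Or.inr (Or.inr ⟨h, hx2⟩)
    have h1 := measureReal_mono hsub (measure_ne_top μ _)
    have h2 := measureReal_union_le (μ := μ) (B ∩ Iio q₁) ({q₁} ∪ Ioo q₁ q₂)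
    have h3 := measureReal_union_le (μ := μ) {q₁} (Ioo q₁ q₂)
    have h4 : μ.real {q₁} = 0 := by simp [measureReal_def]
    linarith
  have hIooB : Ioo q₁ q₂ ⊆ B := Ioo_subset_Icc_self.trans (hT.ordConnected.out hq₁ hq₂)
  -- the levels between a quarter and a half of the height will do; rounding costs less than one
  -- level, of mass `m ≤ c₀ / 100`
  have hh4 : ((h / 4 : ℕ) : ℝ) ≤ h / 4 := Nat.cast_div_le
  have hh4' : (h : ℝ) / 4 - 3 / 4 ≤ ((h / 4 : ℕ) : ℝ) := by
    have : h ≤ 4 * (h / 4) + 3 := by omega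
    have : (h : ℝ) ≤ 4 * ((h / 4 : ℕ) : ℝ) + 3 := by exact_mod_cast this
    linarith
  have hh2 : ((h / 2 : ℕ) : ℝ) ≤ h / 2 := Nat.cast_div_le
  have hh2' : (h : ℝ) / 2 - 1 / 2 ≤ ((h / 2 : ℕ) : ℝ) := by
    have : h ≤ 2 * (h / 2) + 1 := by omega
    have : (h : ℝ) ≤ 2 * ((h / 2 : ℕ) : ℝ) + 1 := by exact_mod_cast this
    linarith
  have hsub : ⋃ l ∈ Finset.Ico (h / 4) (h / 2), f^[l] '' Ioo q₁ q₂ ⊆ splitSet f μ (c₀ / 24) δ := by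
    intro t ht
    simp only [Finset.mem_Ico, mem_iUnion, exists_prop] at ht
    obtain ⟨l, ⟨hl1, hl2⟩, ht⟩ := ht
    obtain ⟨a, rfl⟩ : ∃ a, h = l + 1 + a := Nat.exists_eq_add_of_le (by omega)
    refine ⟨B, l, a, q₁, q₂, hT, ?_, hm0, hmδ, ?_, ?_, hq₁, hq₂, ?_, ?_, ht⟩
    · intro x hx y hy
      have hx1 : (p : ℝ) ≤ x := (hBJ hx).1
      have hx2 : (x : ℝ) < q := (hBJ hx).2
      have hy1 : (p : ℝ) ≤ y := (hBJ hy).1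
      have hy2 : (y : ℝ) < q := (hBJ hy).2
      have := hlen.trans (min_le_left _ _)
      rw [abs_le]
      constructor <;> linarith
    · have h1 : (((l + 1 + a) / 4 : ℕ) : ℝ) ≤ l := by exact_mod_cast hl1
      have h2 : (((l + 1 + a : ℕ) : ℝ) / 4 - 3 / 4) * m ≤ l * m :=
        mul_le_mul_of_nonneg_right (hh4'.trans h1) hm0.le
      linarith
    · have h1 : (l : ℝ) + 1 ≤ (((l + 1 + a) / 2 : ℕ) : ℝ) := by exact_mod_cast hl2
      have h2 : ((l + 1 + a : ℕ) : ℝ) / 2 ≤ a := by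
        push_cast at hh2 ⊢
        linarith
      have h3 := mul_le_mul_of_nonneg_right h2 hm0.le
      linarith
    · rw [hq₁m]
      nlinarith
    · rw [hq₂m']
      nlinarith
  calc c₀ / 24 ≤ (((h / 2 : ℕ) : ℝ) - ((h / 4 : ℕ) : ℝ)) * (m / 3) := by
        have h1 : ((h : ℝ) / 4 - 1 / 2) * (m / 3) ≤
            (((h / 2 : ℕ) : ℝ) - ((h / 4 : ℕ) : ℝ)) * (m / 3) :=
          mul_le_mul_of_nonneg_right (by linarith) (by positivity)
        linarith
    _ = ∑ l ∈ Finset.Ico (h / 4) (h / 2), m / 3 := by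
        rw [Finset.sum_const, Nat.card_Ico, nsmul_eq_mul, Nat.cast_sub (by omega)]
    _ ≤ ∑ l ∈ Finset.Ico (h / 4) (h / 2), μ.real (f^[l] '' Ioo q₁ q₂) := by
        refine Finset.sum_le_sum fun l _ => ?_
        rw [measureReal_def, measure_iterate_image hμ.toMeasurePreserving]
        exact hIoo
    _ = μ.real (⋃ l ∈ Finset.Ico (h / 4) (h / 2), f^[l] '' Ioo q₁ q₂) := by
        refine (measureReal_biUnion_finset ?_ fun l _ => ?_).symm
        · intro i hi j hj hij
          simp only [Finset.coe_Ico, mem_Ico] at hi hj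
          exact (hT.level_disjoint (by omega) (by omega) hij).mono (image_mono hIooB)
            (image_mono hIooB)
        · exact (measurableEmbedding_iterate hμ.measurable l).measurableSet_image.2
            measurableSet_Ioo
    _ ≤ μ.real (splitSet f μ (c₀ / 24) δ) := measureReal_mono hsub (measure_ne_top _ _)

/-- The points that are split at every scale, with a proportion that does not depend on the scale. -/
def deepSplitSet (f : Equiv.Perm (Space b)) (μ : Measure (Space b)) (c : ℝ) : Set (Space b) :=
  ⋂ n : ℕ, splitSet f μ c (1 / ((n : ℝ) + 1))

lemma measurableSet_deepSplitSet (c : ℝ) : MeasurableSet (deepSplitSet f μ c) :=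
  MeasurableSet.iInter fun _ => (isOpen_splitSet _ _).measurableSet

lemma mem_splitSet_of_mem_deepSplitSet {c δ : ℝ} (hδ : 0 < δ) {t : Space b}
    (ht : t ∈ deepSplitSet f μ c) : t ∈ splitSet f μ c δ := by
  obtain ⟨n, hn⟩ := exists_nat_one_div_lt hδ
  exact splitSet_mono_right hn.le (mem_iInter.1 ht n)

lemma zpow_mem_deepSplitSet {c : ℝ} (hc : 0 < c) (k : ℤ) {t : Space b}
    (ht : t ∈ deepSplitSet f μ c) : (f ^ k) t ∈ deepSplitSet f μ (c / 2) := by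
  refine mem_iInter.2 fun n => ?_
  have hδ : 0 < min (1 / ((n : ℝ) + 1)) (c / 2 / (|(k : ℝ)| + 1)) := by positivity
  refine splitSet_mono_right (min_le_left _ _)
    (zpow_mem_splitSet hc ?_ (mem_splitSet_of_mem_deepSplitSet hδ ht))
  calc |(k : ℝ)| * min (1 / ((n : ℝ) + 1)) (c / 2 / (|(k : ℝ)| + 1))
      ≤ (|(k : ℝ)| + 1) * (c / 2 / (|(k : ℝ)| + 1)) := by
        gcongr
        · linarith
        · exact min_le_right _ _
    _ = c / 2 := by field_simp

/-- If the split points have measure bounded below at every scale, they are dense at every scale: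
by minimality, finitely many images of a given open set fill almost the whole space, so they
meet the split points. -/
lemma dense_splitSet (hmin : IsMinimal f) [IsProbabilityMeasure μ]
    {c : ℝ} (hc : 0 < c) (h : ∀ δ > 0, c ≤ μ.real (splitSet f μ c δ)) {δ : ℝ} (hδ : 0 < δ) :
    Dense (splitSet f μ (c / 2) δ) := by
  rw [dense_iff_inter_open]
  intro U hU hne
  let W : ℕ → Set (Space b) := fun K => ⋃ k ∈ Finset.Icc (-(K : ℤ)) K, (f ^ k) '' U
  have hWmono : Monotone W := by
    intro K K' hK
    refine biUnion_subset_biUnion_left fun k hk => ?_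
    simp only [Finset.coe_Icc, mem_Icc] at hk ⊢
    omega
  have hWuniv : ⋃ K, W K = univ := by
    refine eq_univ_of_forall fun x => ?_
    have hx : x ∈ ⋃ k : ℤ, (f ^ k) '' U := by rw [hmin.iUnion_zpow_image hU hne]; trivial
    obtain ⟨k, hk⟩ := mem_iUnion.1 hx
    refine mem_iUnion.2 ⟨k.natAbs, mem_biUnion (x := k) ?_ hk⟩
    simp only [Finset.coe_Icc, mem_Icc]
    omega
  have hlim := tendsto_measure_iUnion_atTop (μ := μ) hWmono
  rw [hWuniv, measure_univ] at hlim
  obtain ⟨K, hK⟩ : ∃ K, 1 - c < μ.real (W K) := by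
    have h1 : Tendsto (fun K => μ.real (W K)) atTop (𝓝 1) := by
      exact (ENNReal.tendsto_toReal ENNReal.one_ne_top).comp hlim
    exact (h1.eventually_const_lt (show 1 - c < 1 by linarith)).exists
  set δ' := min δ (c / 2 / ((K : ℝ) + 1)) with hδ'
  have hδ'pos : 0 < δ' := by positivity
  obtain ⟨x, hxW, hxS⟩ : (W K ∩ splitSet f μ c δ').Nonempty := by
    by_contra hemp
    have hdis : Disjoint (W K) (splitSet f μ c δ') :=
      disjoint_iff_inter_eq_empty.2 (not_nonempty_iff_eq_empty.1 hemp)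
    have h1 := measureReal_union hdis (isOpen_splitSet (f := f) (μ := μ) c δ').measurableSet
      (h₁ := measure_ne_top μ _) (h₂ := measure_ne_top μ _)
    have h2 : μ.real (W K ∪ splitSet f μ c δ') ≤ 1 := measureReal_le_one
    linarith [h δ' hδ'pos]
  simp only [W, Finset.mem_Icc, mem_iUnion, exists_prop] at hxW
  obtain ⟨k, hk, u, hu, rfl⟩ := hxW
  refine ⟨u, hu, ?_⟩
  have hkabs : |((-k : ℤ) : ℝ)| ≤ K := by
    rw [abs_le]
    push_cast
    have h1 : (-(K : ℝ)) ≤ k := by exact_mod_cast hk.1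
    have h2 : (k : ℝ) ≤ K := by exact_mod_cast hk.2
    constructor <;> linarith
  have hmem := zpow_mem_splitSet (k := -k) hc (δ := δ') ?_ hxS
  · have : (f ^ (-k)) ((f ^ k) u) = u := by simp
    rw [this] at hmem
    exact splitSet_mono_right (min_le_left _ _) hmem
  · calc |((-k : ℤ) : ℝ)| * δ' ≤ ((K : ℝ) + 1) * (c / 2 / ((K : ℝ) + 1)) := by
          gcongr
          · linarith
          · exact min_le_right _ _
      _ = c / 2 := by field_simp

/-- The points split at every scale with proportion `c` have positive measure. By ergodicity almost
every point is on the orbit of one of them, and so is split with proportion `c / 2`. -/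
lemma ae_mem_deepSplitSet [IsProbabilityMeasure μ] (hμ : Ergodic f μ)
    {c : ℝ} (hc : 0 < c) (h : ∀ δ > 0, c ≤ μ.real (splitSet f μ c δ)) :
    ∀ᵐ t ∂μ, t ∈ deepSplitSet f μ (c / 2) := by
  have hpos : μ (deepSplitSet f μ c) ≠ 0 := by
    have hanti : Antitone fun n : ℕ => splitSet f μ c (1 / ((n : ℝ) + 1)) := fun m n hmn =>
      splitSet_mono_right (one_div_le_one_div_of_le (by positivity)
        (by have : (m : ℝ) ≤ n := by exact_mod_cast hmn
            linarith))
    have hlim := tendsto_measure_iInter_atTop (μ := μ)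
      (fun n : ℕ => (isOpen_splitSet (f := f) (μ := μ) c (1 / ((n : ℝ) + 1))).nullMeasurableSet)
      hanti ⟨0, measure_ne_top _ _⟩
    have hge : ENNReal.ofReal c ≤ μ (deepSplitSet f μ c) :=
      ge_of_tendsto' hlim fun n => by
        rw [Function.comp_apply, ← ENNReal.ofReal_toReal (measure_ne_top μ (splitSet f μ c _))]
        exact ENNReal.ofReal_le_ofReal (h _ (by positivity))
    exact (lt_of_lt_of_le (by simpa using hc) hge).ne'
  filter_upwards [ae_exists_iterate_eq hμ (measurableSet_deepSplitSet c) hpos] with x hx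
  obtain ⟨k, z, hz, rfl⟩ := hx
  rw [Equiv.Perm.iterate_eq_pow, ← zpow_natCast]
  exact zpow_mem_deepSplitSet hc k hz

/-! ### Rigidity of the cocycle equation at split points -/

/-- A quantitative form of Lusin's theorem: off a small set, an integrable function varies little on
small intervals. -/
lemma exists_measurableSet_approx_uniformContinuous [IsFiniteMeasure μ] {F : Space b → ℂ}
    (hF : Integrable F μ) {η ε : ℝ} (hη : 0 < η) (hε : 0 < ε) :
    ∃ E, μ.real E ≤ ε ∧ ∃ δ > 0, ∀ x ∉ E, ∀ y ∉ E, |(x : ℝ) - y| ≤ δ → ‖F x - F y‖ ≤ η := by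
  have : LocallyCompactSpace (Space b) :=
    (isOpen_Iio.isLocallyClosed.inter isClosed_Ici.isLocallyClosed :
      IsLocallyClosed (Iio b ∩ Ici 0)) |> fun h => by
        rw [inter_comm, Ici_inter_Iio] at h
        exact h.locallyCompactSpace
  obtain ⟨g, hgsupp, hgF, hgc, hgi⟩ := hF.exists_hasCompactSupport_integral_sub_le
    (ε := η / 3 * ε) (by positivity)
  have hgu : UniformContinuous g := hgsupp.uniformContinuous_of_continuous hgc
  obtain ⟨δ, hδ, hgδ⟩ := Metric.uniformContinuous_iff.1 hgu (η / 3) (by positivity)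
  refine ⟨{x | η / 3 ≤ ‖F x - g x‖}, ?_, δ / 2, by positivity, ?_⟩
  · have h1 := mul_meas_ge_le_integral_of_nonneg (μ := μ) (f := fun x => ‖F x - g x‖)
      (Eventually.of_forall fun x => norm_nonneg _) (hF.sub hgi).norm (η / 3)
    exact le_of_mul_le_mul_left (h1.trans hgF) (by positivity)
  · intro x hx y hy hxy
    simp only [mem_ofPred_eq, not_le] at hx hy
    have h1 : dist (g x) (g y) < η / 3 := by
      apply hgδ
      rw [Subtype.dist_eq, Real.dist_eq]
      linarith
    rw [dist_eq_norm] at h1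
    have h2 : F x - F y = (F x - g x) + (g x - g y) - (F y - g y) := by ring
    rw [h2]
    exact (norm_sub_le _ _).trans (by linarith [norm_add_le (F x - g x) (g x - g y)])

/-- Among levels of a tower with total mass at least `c`, a small set occupies a small proportion of
at least one. -/
lemma IsTower.exists_level_lt [IsFiniteMeasure μ] (hf : MeasurePreserving f μ μ)
    {B : Set (Space b)} {h : ℕ} (hT : IsTower f B h) {E : Set (Space b)} (hE : MeasurableSet E)
    {c : ℝ} {s : Finset ℕ} (hs : ∀ k ∈ s, k < h) (hcs : c ≤ s.card * μ.real B) {r : ℝ}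
    (hr : 0 < r) (hEr : μ.real E < r * c) :
    ∃ k ∈ s, μ.real (B ∩ f^[k] ⁻¹' E) < r * μ.real B := by
  by_contra! hcon
  have hBm : MeasurableSet B := hT.ordConnected.measurableSet
  have himg : ∀ k, f^[k] '' (B ∩ f^[k] ⁻¹' E) = f^[k] '' B ∩ E := fun k =>
    image_inter_preimage _ _ _
  have h1 : ∑ k ∈ s, μ.real (B ∩ f^[k] ⁻¹' E) ≤ μ.real E := by
    calc ∑ k ∈ s, μ.real (B ∩ f^[k] ⁻¹' E) = ∑ k ∈ s, μ.real (f^[k] '' B ∩ E) := by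
          refine Finset.sum_congr rfl fun k _ => ?_
          rw [← himg, measureReal_def, measureReal_def, measure_iterate_image hf]
      _ = μ.real (⋃ k ∈ s, f^[k] '' B ∩ E) := by
          refine (measureReal_biUnion_finset ?_ fun k _ => ?_).symm
          · intro i hi j hj hij
            exact (hT.level_disjoint (hs i hi) (hs j hj) hij).mono inter_subset_left
              inter_subset_left
          · exact ((measurableEmbedding_iterate hf.measurable k).measurableSet_image.2 hBm).inter hE
      _ ≤ μ.real E := measureReal_mono (iUnion₂_subset fun _ _ => inter_subset_right)
          (measure_ne_top _ _)
  have h2 := Finset.card_nsmul_le_sum s _ _ hcon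
  rw [nsmul_eq_mul] at h2
  nlinarith

lemma pos_of_mem_splitSet {c δ : ℝ} {t : Space b} (ht : t ∈ splitSet f μ c δ) : 0 < (t : ℝ) := by
  obtain ⟨B, l, a, q₁, q₂, hT, -, -, -, -, -, hq₁, hq₂, -, -, ht⟩ := ht
  rw [(hT.translation l (by omega)).image_Ioo hT.ordConnected hq₁ hq₂] at ht
  exact (f^[l] q₁).2.1.trans_lt ht.1

lemma iterate_cocycle {χ F : Space b → ℂ} {x : Space b}
    (hx : ∀ j, F (f^[j + 1] x) = χ (f^[j] x) * F (f^[j] x)) {i k : ℕ} (hik : i ≤ k) :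
    F (f^[k] x) = (∏ j ∈ Finset.Ico i k, χ (f^[j] x)) * F (f^[i] x) := by
  induction k, hik using Nat.le_induction with
  | base => simp
  | succ k hik ih => rw [hx, ih, Finset.prod_Ico_succ_top hik]; ring

/-- The key rigidity step. Follow two points of a block, one on either side of `t` in the level of
`t`, from a level below to a level above. They pass the same factors except for one `θ`, yet the
transfer function takes nearly the same value at both, before and after. Hence `θ = 1`. -/
lemma eq_one_of_cocycle [IsProbabilityMeasure μ] (hf : MeasurePreserving f μ μ) {c : ℝ}
    (hc : 0 < c) {t : Space b} (ht : t ∈ deepSplitSet f μ c) {θ : ℂ} (hθ : ‖θ‖ = 1)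
    {F : Space b → ℂ} (hF : Measurable F) (hF1 : ∀ᵐ x ∂μ, ‖F x‖ = 1)
    (hFf : ∀ᵐ x ∂μ, F (f x) = (if x < t then θ else 1) * F x) : θ = 1 := by
  suffices H : ∀ η > 0, ‖θ - 1‖ ≤ 2 * η by
    rw [← sub_eq_zero, ← norm_eq_zero]
    refine le_antisymm (le_of_forall_pos_le_add fun η hη => ?_) (norm_nonneg _)
    linarith [H (η / 2) (by positivity)]
  intro η hη
  set χ : Space b → ℂ := fun x => if x < t then θ else 1 with hχ
  have hFi : Integrable F μ := by
    refine Integrable.of_bound hF.aestronglyMeasurable 1 ?_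
    filter_upwards [hF1] with x hx using hx.le
  obtain ⟨E₀, hE₀, δ, hδ, hvar⟩ :=
    exists_measurableSet_approx_uniformContinuous hFi hη (show 0 < c / 4 * c by positivity)
  -- enlarge the exceptional set by the points whose orbit misbehaves
  have hgood : ∀ᵐ x ∂μ, ∀ j, F (f^[j + 1] x) = χ (f^[j] x) * F (f^[j] x) ∧ ‖F (f^[j] x)‖ = 1 := by
    rw [ae_all_iff]
    intro j
    have := (hf.iterate j).quasiMeasurePreserving.ae (hFf.and hF1)
    filter_upwards [this] with x hx
    rw [Function.iterate_succ_apply']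
    exact hx
  set E₁ := E₀ ∪ {x | ¬ ∀ j, F (f^[j + 1] x) = χ (f^[j] x) * F (f^[j] x) ∧ ‖F (f^[j] x)‖ = 1}
    with hE₁
  set E := toMeasurable μ E₁ with hE
  have hEm : MeasurableSet E := measurableSet_toMeasurable _ _
  have hE₁E : E₁ ⊆ E := subset_toMeasurable _ _
  have hEc : μ.real E < c / 2 * c := by
    have h1 : μ.real E = μ.real E₁ := by
      rw [measureReal_def, hE, measure_toMeasurable, measureReal_def]
    have h2 : μ.real E₁ ≤ μ.real E₀ + 0 := by
      refine (measureReal_union_le _ _).trans (le_of_eq ?_)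
      congr 1
      rw [measureReal_def, ae_iff.1 hgood, ENNReal.toReal_zero]
    nlinarith
  obtain ⟨B, l, a, q₁, q₂, hT, hdiam, hm0, -, hl, ha, hq₁, hq₂, h1, h2, z, hz, hzt⟩ :=
    mem_splitSet_of_mem_deepSplitSet hδ ht
  obtain ⟨k, hk, hkE⟩ := hT.exists_level_lt hf hEm (s := Finset.range l) (c := c)
    (fun k hk => by rw [Finset.mem_range] at hk; omega) (by simpa using hl)
    (show 0 < c / 2 by positivity) hEc
  obtain ⟨k', hk', hkE'⟩ := hT.exists_level_lt hf hEm (s := Finset.Ico (l + 1) (l + 1 + a)) (c := c)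
    (fun k hk => by rw [Finset.mem_Ico] at hk; omega) (by simpa using ha)
    (show 0 < c / 2 by positivity) hEc
  rw [Finset.mem_range] at hk
  rw [Finset.mem_Ico] at hk'
  have hpick : ∀ P ⊆ B, c * μ.real B ≤ μ.real P → ∃ x ∈ P, f^[k] x ∉ E ∧ f^[k'] x ∉ E := by
    intro P hPB hP
    by_contra! hcon
    have hsub : P ⊆ (B ∩ f^[k] ⁻¹' E) ∪ (B ∩ f^[k'] ⁻¹' E) := by
      intro x hx
      by_cases hxE : f^[k] x ∈ E
      · exact Or.inl ⟨hPB hx, hxE⟩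
      · exact Or.inr ⟨hPB hx, hcon x hx hxE⟩
    have h3 := measureReal_mono hsub (measure_ne_top μ _)
    have h4 := measureReal_union_le (μ := μ) (B ∩ f^[k] ⁻¹' E) (B ∩ f^[k'] ⁻¹' E)
    linarith
  obtain ⟨x, ⟨hxB, hxq⟩, hxk, hxk'⟩ := hpick _ inter_subset_left h1
  obtain ⟨y, ⟨hyB, hyq⟩, hyk, hyk'⟩ := hpick _ inter_subset_left h2
  have hnotE : ∀ u ∉ E, u ∉ E₀ ∧
      ∀ j, F (f^[j + 1] u) = χ (f^[j] u) * F (f^[j] u) ∧ ‖F (f^[j] u)‖ = 1 := by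
    intro u hu
    have hu' : u ∉ E₁ := fun h => hu (hE₁E h)
    rw [hE₁, mem_union, not_or, mem_ofPred_eq, not_not] at hu'
    exact hu'
  have hclose : ∀ j < l + 1 + a, f^[j] x ∉ E → f^[j] y ∉ E →
      ‖F (f^[j] x) - F (f^[j] y)‖ ≤ η := by
    intro j hj hxj hyj
    refine hvar _ (hnotE _ hxj).1 _ (hnotE _ hyj).1 ?_
    rw [hT.translation j hj x hxB y hyB]
    exact hdiam x hxB y hyB
  -- transport from level `k` to level `k'`
  obtain ⟨n, rfl⟩ : ∃ n, k' = n + k := ⟨k' - k, by omega⟩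
  have htransport : ∀ u, f^[k] u ∉ E →
      F (f^[n + k] u) = (∏ j ∈ Finset.Ico 0 n, χ (f^[j + k] u)) * F (f^[k] u) := by
    intro u hu
    have := iterate_cocycle (χ := χ) (F := F) (fun j => ((hnotE _ hu).2 j).1) (Nat.zero_le n)
    simpa only [← Function.iterate_add_apply, zero_add] using this
  have hzB : z ∈ B := hT.ordConnected.out hq₁ hq₂ (Ioo_subset_Icc_self hz)
  -- away from level `l` the block does not meet `t`
  have hsame : ∀ j < l + 1 + a, j ≠ l → χ (f^[j] x) = χ (f^[j] y) := by
    intro j hj hjl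
    have htj : t ∉ f^[j] '' B := fun h =>
      (Set.disjoint_left.1 (hT.level_disjoint hj (show l < l + 1 + a by omega) hjl) h)
        ⟨z, hzB, hzt⟩
    have hord := (hT.translation j hj).image_ordConnected hT.ordConnected
    have hxj : f^[j] x ∈ f^[j] '' B := mem_image_of_mem _ hxB
    have hyj : f^[j] y ∈ f^[j] '' B := mem_image_of_mem _ hyB
    have hiff : f^[j] x < t ↔ f^[j] y < t := by
      constructor
      · intro h
        by_contra h'
        exact htj (hord.out hxj hyj ⟨h.le, not_lt.1 h'⟩)
      · intro h
        by_contra h'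
        exact htj (hord.out hyj hxj ⟨h.le, not_lt.1 h'⟩)
    simp only [hχ, hiff]
  have htrl := hT.translation l (by omega)
  have hχx : χ (f^[l] x) = θ := by
    have : f^[l] x < t := hzt ▸ (htrl.lt_iff hxB hzB).2 (lt_trans hxq hz.1)
    simp [hχ, this]
  have hχy : χ (f^[l] y) = 1 := by
    have : ¬ f^[l] y < t :=
      not_lt.2 (hzt ▸ (htrl.le_iff hzB hyB).2 (hz.2.le.trans hyq))
    simp [hχ, this]
  set p := ∏ j ∈ Finset.Ico 0 n, χ (f^[j + k] y) with hp
  have hprod : ∏ j ∈ Finset.Ico 0 n, χ (f^[j + k] x) = θ * p := by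
    have hmem : l - k ∈ Finset.Ico 0 n := by
      rw [Finset.mem_Ico]
      omega
    rw [hp, ← Finset.mul_prod_erase _ _ hmem, ← Finset.mul_prod_erase _ _ hmem,
      Nat.sub_add_cancel hk.le, hχx, hχy, one_mul]
    congr 1
    refine Finset.prod_congr rfl fun j hj => ?_
    rw [Finset.mem_erase, Finset.mem_Ico] at hj
    exact hsame _ (by omega) (by omega)
  have hχnorm : ∀ u, ‖χ u‖ = 1 := by
    intro u
    simp only [hχ]
    split_ifs
    · exact hθ
    · exact norm_one
  have hpnorm : ‖p‖ = 1 := by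
    rw [hp, norm_prod]
    exact Finset.prod_eq_one fun j _ => hχnorm _
  have hk1 := hclose k (by omega) hxk hyk
  have hk2 := hclose (n + k) (by omega) hxk' hyk'
  rw [htransport x hxk, htransport y hyk, hprod, ← hp,
    show θ * p * F (f^[k] x) - p * F (f^[k] y) = p * (θ * F (f^[k] x) - F (f^[k] y)) by ring,
    norm_mul, hpnorm, one_mul] at hk2
  have hFx : ‖F (f^[k] x)‖ = 1 := ((hnotE _ hxk).2 0).2
  calc ‖θ - 1‖ = ‖(θ - 1) * F (f^[k] x)‖ := by rw [norm_mul, hFx, mul_one]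
    _ = ‖(θ * F (f^[k] x) - F (f^[k] y)) - (F (f^[k] x) - F (f^[k] y))‖ := by
        congr 1
        ring
    _ ≤ 2 * η := (norm_sub_le _ _).trans (by linarith)

/-- A function that does not decrease along the orbits of a transformation preserving a finite
measure is invariant. -/
lemma ae_eq_comp_of_le_comp {α : Type*} [MeasurableSpace α] {ν : Measure α} [IsFiniteMeasure ν]
    {T : α → α} (hT : MeasurePreserving T ν ν) {r : α → ℝ} (hr : Measurable r)
    (hle : ∀ᵐ x ∂ν, r x ≤ r (T x)) : r ∘ T =ᵐ[ν] r := by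
  -- compose with a bounded strictly monotone function to gain integrability
  have hint : ∀ s : α → ℝ, Measurable s → Integrable (fun x => Real.arctan (s x)) ν := by
    intro s hs
    refine Integrable.of_bound (Real.measurable_arctan.comp hs).aestronglyMeasurable
      (Real.pi / 2) (Eventually.of_forall fun x => ?_)
    rw [Real.norm_eq_abs, abs_le]
    exact ⟨(Real.neg_pi_div_two_lt_arctan _).le, (Real.arctan_lt_pi_div_two _).le⟩
  have heq : ∫ x, Real.arctan (r x) ∂ν = ∫ x, Real.arctan (r (T x)) ∂ν := by
    have h1 := integral_map (μ := ν) hT.measurable.aemeasurable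
      (f := fun x => Real.arctan (r x)) (by
        rw [hT.map_eq]
        exact (hint r hr).aestronglyMeasurable)
    rw [hT.map_eq] at h1
    exact h1
  have h2 := (integral_eq_iff_of_ae_le (hint r hr) (hint _ (hr.comp hT.measurable)) (by
    filter_upwards [hle] with x hx using Real.arctan_strictMono.monotone hx)).1 heq
  filter_upwards [h2] with x hx
  exact (Real.arctan_injective hx).symm

/-- At a point split at every scale, the cocycle equation has only constant solutions. -/
lemma ae_eq_const_of_cocycle (hmin : IsMinimal f) [IsProbabilityMeasure μ] (hμ : Ergodic f μ)
    {c : ℝ} (hc : 0 < c) {t : Space b} (ht : t ∈ deepSplitSet f μ c) {θ : ℂ}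
    {F : Space b → ℂ} (hF : Measurable F)
    (hFf : ∀ᵐ x ∂μ, F (f x) = (if x < t then θ else 1) * F x) : ∃ d : ℂ, ∀ᵐ x ∂μ, F x = d := by
  have hmp := hμ.toMeasurePreserving
  -- the modulus of `F` is invariant
  have hinv : (fun x => ‖F x‖) ∘ f =ᵐ[μ] fun x => ‖F x‖ := by
    rcases le_total 1 ‖θ‖ with h | h
    · refine ae_eq_comp_of_le_comp hmp hF.norm ?_
      filter_upwards [hFf] with x hx
      rw [hx, norm_mul]
      split_ifs
      · exact le_mul_of_one_le_left (norm_nonneg _) h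
      · simp
    · have h1 := ae_eq_comp_of_le_comp hmp (r := fun x => -‖F x‖) hF.norm.neg (by
        filter_upwards [hFf] with x hx
        rw [hx, norm_mul, neg_le_neg_iff]
        split_ifs
        · exact mul_le_of_le_one_left (norm_nonneg _) h
        · simp)
      filter_upwards [h1] with x hx
      exact neg_injective hx
  obtain ⟨r, hr⟩ := hμ.quasiErgodic.ae_eq_const_of_ae_eq_comp_ae
    hF.norm.aestronglyMeasurable hinv
  rcases eq_or_ne r 0 with rfl | hr0
  · refine ⟨0, ?_⟩
    filter_upwards [hr] with x hx
    simpa using hx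
  have hθ : ‖θ‖ = 1 := by
    have hpos : 0 < μ (Iio t) := by
      have h0 : 0 < (t : ℝ) := pos_of_mem_splitSet (mem_splitSet_of_mem_deepSplitSet one_pos ht)
      exact hmin.measure_pos hmp isOpen_Iio
        ⟨⟨0, le_rfl, h0.trans t.2.2⟩, mem_Iio.2 (Subtype.coe_lt_coe.1 h0)⟩
    obtain ⟨x, hxt, hx1, hx2, hx3⟩ : ∃ x, x < t ∧ F (f x) = (if x < t then θ else 1) * F x ∧
        ‖F (f x)‖ = ‖F x‖ ∧ ‖F x‖ = r := by
      have hfreq : ∃ᵐ x ∂μ, x ∈ Iio t := frequently_ae_mem_iff.2 hpos.ne'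
      exact (hfreq.and_eventually (hFf.and (hinv.and hr))).exists
    rw [hx1, if_pos hxt, norm_mul, hx3] at hx2
    exact mul_right_cancel₀ hr0 (by rw [hx2, one_mul])
  have hθ1 : θ = 1 := by
    refine eq_one_of_cocycle hmp hc ht hθ (F := fun x => F x / r) (hF.div_const _) ?_ ?_
    · filter_upwards [hr] with x hx
      have hx' : ‖F x‖ = r := hx
      have : 0 ≤ r := hx' ▸ norm_nonneg _
      rw [norm_div, hx', Complex.norm_real, Real.norm_eq_abs, abs_of_nonneg this, div_self hr0]
    · filter_upwards [hFf] with x hx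
      rw [hx, mul_div_assoc]
  refine hμ.quasiErgodic.ae_eq_const_of_ae_eq_comp_ae hF.aestronglyMeasurable ?_
  filter_upwards [hFf] with x hx
  simp [hx, hθ1]

/-! ### Induced maps -/

section Induced

variable {α : Type*} {f : α → α} {A : Set α}

/-- The first time `n ≥ 1` at which the orbit of `x` is in `A`, and `0` if there is none. -/
noncomputable def returnTime (f : α → α) (A : Set α) (x : α) : ℕ := sInf {n | 1 ≤ n ∧ f^[n] x ∈ A}

/-- The first time `n ≥ 0` at which the orbit of `x` is in `A`, and `0` if there is none. -/
noncomputable def visitTime (f : α → α) (A : Set α) (x : α) : ℕ := sInf {n | f^[n] x ∈ A}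

lemma coe_inducedMap (x : A) : (inducedMap f A x : α) = f^[returnTime f A x] x := by
  classical
  unfold inducedMap
  split_ifs with h
  · simp only
    congr 2
    rw [returnTime, Nat.sInf_def (s := {n | 1 ≤ n ∧ f^[n] (x : α) ∈ A}) h]
    congr
  · have : {n | 1 ≤ n ∧ f^[n] (x : α) ∈ A} = ∅ := by
      rw [eq_empty_iff_forall_notMem]
      exact fun n hn => h ⟨n, hn⟩
    simp [returnTime, this]

variable [MeasurableSpace α] {μ : Measure α}

lemma measurable_sInf_nat {P : ℕ → α → Prop} (hP : ∀ n, MeasurableSet {x | P n x}) :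
    Measurable fun x => sInf {n | P n x} := by
  classical
  refine measurable_of_Iic fun m => ?_
  have : (fun x => sInf {n | P n x}) ⁻¹' Iic m =
      (⋂ n, {x | P n x}ᶜ) ∪ ⋃ n ∈ Iic m, {x | P n x} := by
    ext x
    simp only [mem_preimage, mem_Iic, mem_union, mem_iInter, mem_compl_iff, mem_iUnion,
      exists_prop]
    constructor
    · intro h
      by_cases hne : {n | P n x}.Nonempty
      · exact Or.inr ⟨_, h, Nat.sInf_mem hne⟩
      · exact Or.inl fun n hn => hne ⟨n, hn⟩
    · rintro (h | ⟨n, hn, hx⟩)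
      · have : {n | P n x} = ∅ := eq_empty_iff_forall_notMem.2 h
        simp [this]
      · exact (Nat.sInf_le hx).trans hn
  rw [this]
  exact (MeasurableSet.iInter fun n => (hP n).compl).union
    (MeasurableSet.biUnion (to_countable _) fun n _ => hP n)

lemma measurable_returnTime (hf : Measurable f) (hA : MeasurableSet A) :
    Measurable (returnTime f A) := by
  refine measurable_sInf_nat fun n => ?_
  by_cases hn : 1 ≤ n
  · simp only [hn, true_and]
    exact hf.iterate n hA
  · simp [hn]

lemma measurable_visitTime (hf : Measurable f) (hA : MeasurableSet A) :
    Measurable (visitTime f A) :=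
  measurable_sInf_nat fun n => hf.iterate n hA

lemma measurable_iterate_time (hf : Measurable f) {τ : α → ℕ} (hτ : Measurable τ) :
    Measurable fun x => f^[τ x] x :=
  (measurable_from_prod_countable_right (f := fun p : ℕ × α => f^[p.1] p.2)
    fun n => hf.iterate n).comp (hτ.prodMk measurable_id)

lemma measurable_inducedMap (hf : Measurable f) (hA : MeasurableSet A) :
    Measurable (inducedMap f A) := by
  refine (MeasurableEmbedding.subtype_coe hA).measurable_comp_iff.1 ?_
  have : (Subtype.val ∘ inducedMap f A) = fun x : A => f^[returnTime f A x] x :=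
    funext coe_inducedMap
  rw [this]
  exact (measurable_iterate_time hf (measurable_returnTime hf hA)).comp measurable_subtype_coe

lemma ae_comap_val_iff (hA : MeasurableSet A) {P : A → Prop} :
    (∀ᵐ x ∂(μ.comap Subtype.val), P x) ↔ ∀ᵐ x ∂μ, ∀ hx : x ∈ A, P ⟨x, hx⟩ := by
  rw [ae_iff, ae_iff, comap_subtype_coe_apply hA]
  congr! 2
  ext x
  simp

/-- An injective measure preserving map induces a measure preserving map on `A`: the pieces of
constant return time have disjoint images, so the induced map does not increase measure; as the
total mass is finite, it preserves it. -/
lemma measurePreserving_inducedMap [IsFiniteMeasure μ] (hf : MeasurePreserving f μ μ)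
    (hemb : MeasurableEmbedding f) (hA : MeasurableSet A) :
    MeasurePreserving (inducedMap f A) (μ.comap (Subtype.val : A → α))
      (μ.comap (Subtype.val : A → α)) := by
  have hT := measurable_inducedMap hf.measurable hA
  have hfin : IsFiniteMeasure (μ.comap (Subtype.val : A → α)) :=
    ⟨by rw [comap_subtype_coe_apply hA]; exact measure_lt_top _ _⟩
  have hiter : ∀ n, MeasurableEmbedding (f^[n]) := fun n => by
    induction n with
    | zero => exact MeasurableEmbedding.id
    | succ n ih => exact ih.comp hemb
  have himage : ∀ n (S : Set α), μ (f^[n] '' S) = μ S := fun n S => by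
    have := (hf.iterate n).measure_preimage_emb (hiter n) (f^[n] '' S)
    rwa [preimage_image_eq _ (hiter n).injective, eq_comm] at this
  refine ⟨hT, Measure.eq_of_le_of_measure_univ_eq ?_ ?_⟩
  swap
  · rw [Measure.map_apply hT MeasurableSet.univ, preimage_univ]
  refine Measure.le_iff.2 fun S hS => ?_
  rw [Measure.map_apply hT hS, comap_subtype_coe_apply hA, comap_subtype_coe_apply hA]
  have hSα : MeasurableSet (Subtype.val '' S : Set α) := hA.subtype_image hS
  -- `D n` is the part of the preimage of `S` that returns at time `n`
  let D : ℕ → Set α := fun n =>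
    A ∩ {x | 1 ≤ n ∧ returnTime f A x = n} ∩ f^[n] ⁻¹' (Subtype.val '' S)
  have hD : ∀ n, MeasurableSet (D n) := fun n => by
    refine (hA.inter ?_).inter (hf.measurable.iterate n hSα)
    by_cases hn : 1 ≤ n
    · simp only [hn, true_and]
      exact measurable_returnTime hf.measurable hA (measurableSet_singleton n)
    · simp [hn]
  have hret : ∀ᵐ x ∂μ, x ∈ A → ∃ n, 1 ≤ n ∧ f^[n] x ∈ A := by
    filter_upwards [hf.conservative.ae_mem_imp_frequently_image_mem hA.nullMeasurableSet]
      with x hx hxA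
    obtain ⟨n, hn, hnA⟩ := (hx hxA).forall_exists_of_atTop 1
    exact ⟨n, hn, hnA⟩
  have hcover : (Subtype.val '' (inducedMap f A ⁻¹' S) : Set α) ≤ᵐ[μ] ⋃ n, D n := by
    filter_upwards [hret] with x hx hxS
    obtain ⟨y, hy, rfl⟩ := hxS
    have hmem : 1 ≤ returnTime f A y ∧ f^[returnTime f A y] (y : α) ∈ A :=
      Nat.sInf_mem (hx y.2)
    refine mem_iUnion.2 ⟨returnTime f A y, ⟨y.2, hmem.1, rfl⟩, ?_⟩
    rw [mem_preimage, ← coe_inducedMap]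
    exact mem_image_of_mem _ hy
  have hnotret : ∀ n, ∀ x ∈ D n, ∀ i, 1 ≤ i → i < n → f^[i] x ∉ A := by
    intro n x hx i hi hin hiA
    have : returnTime f A x ≤ i := Nat.sInf_le ⟨hi, hiA⟩
    rw [hx.1.2.2] at this
    omega
  have hdis : Pairwise (Function.onFun Disjoint fun n => f^[n] '' D n) := by
    intro m n hmn
    wlog hlt : m < n generalizing m n
    · exact (this hmn.symm (by omega)).symm
    rw [Function.onFun, Set.disjoint_left]
    rintro _ ⟨x, hx, rfl⟩ ⟨y, hy, hxy⟩
    obtain ⟨k, rfl⟩ := Nat.exists_eq_add_of_lt hlt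
    rw [add_assoc, Function.iterate_add_apply] at hxy
    have hyx := (hiter m).injective hxy
    have h1 : 1 ≤ m := hx.1.2.1
    exact hnotret _ y hy (k + 1) (by omega) (by omega) (hyx ▸ hx.1.1)
  calc μ (Subtype.val '' (inducedMap f A ⁻¹' S)) ≤ μ (⋃ n, D n) := measure_mono_ae hcover
    _ ≤ ∑' n, μ (D n) := measure_iUnion_le _
    _ = ∑' n, μ (f^[n] '' D n) := by simp only [himage]
    _ = μ (⋃ n, f^[n] '' D n) :=
        (measure_iUnion hdis fun n => (hiter n).measurableSet_image.2 (hD n)).symm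
    _ ≤ μ (Subtype.val '' S) := measure_mono (iUnion_subset fun n => by
        rintro _ ⟨x, hx, rfl⟩
        exact hx.2)

open Classical in
/-- An eigenfunction of the induced map extends, by its value at the first visit to `A`, to a
solution of the cocycle equation for `f` with the factor `θ` on `A` and `1` off `A`. -/
lemma exists_cocycle_of_eigenfunction (hf : MeasurePreserving f μ μ) (hA : MeasurableSet A)
    (hvisit : ∀ᵐ x ∂μ, ∃ n, f^[n] x ∈ A) {θ : ℂ} {G : A → ℂ} (hG : Measurable G)
    (hGT : ∀ᵐ x ∂(μ.comap Subtype.val), G (inducedMap f A x) = θ * G x) :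
    ∃ F : α → ℂ, Measurable F ∧ (∀ᵐ x ∂μ, F (f x) = (if x ∈ A then θ else 1) * F x) ∧
      ∀ x : A, F x = G x := by
  let G' : α → ℂ := Function.extend Subtype.val G 0
  have hG' : Measurable G' :=
    (MeasurableEmbedding.subtype_coe hA).measurable_extend hG measurable_zero
  have hG'A : ∀ x : A, G' x = G x := fun x => Subtype.val_injective.extend_apply _ _ _
  refine ⟨fun x => G' (f^[visitTime f A x] x),
    hG'.comp (measurable_iterate_time hf.measurable (measurable_visitTime hf.measurable hA)),
    ?_, ?_⟩
  · rw [ae_comap_val_iff hA] at hGT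
    filter_upwards [hGT, hvisit, hf.quasiMeasurePreserving.ae hvisit] with x hx hv hv'
    have hstep : f^[visitTime f A (f x)] (f x) = f^[returnTime f A x] x := by
      rw [← Function.iterate_succ_apply]
      congr 2
      have hr : ∃ n, 1 ≤ n ∧ f^[n] x ∈ A := by
        obtain ⟨n, hn⟩ := hv'
        exact ⟨n + 1, by omega, hn⟩
      have h1 : 1 ≤ returnTime f A x ∧ f^[returnTime f A x] x ∈ A := Nat.sInf_mem hr
      have h2 : f^[visitTime f A (f x)] (f x) ∈ A := Nat.sInf_mem hv'
      apply le_antisymm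
      · obtain ⟨m, hm⟩ := Nat.exists_eq_add_of_le h1.1
        have h3 : visitTime f A (f x) ≤ m := by
          refine Nat.sInf_le ?_
          have h4 := h1.2
          rw [hm, add_comm, Function.iterate_succ_apply] at h4
          exact h4
        omega
      · exact Nat.sInf_le ⟨by omega, h2⟩
    by_cases hxA : x ∈ A
    · have h0 : visitTime f A x = 0 := Nat.le_zero.1 (Nat.sInf_le hxA)
      rw [if_pos hxA, hstep, h0, Function.iterate_zero, id, hG'A ⟨x, hxA⟩, ← hx hxA, ← hG'A,
        coe_inducedMap]
    · rw [if_neg hxA, one_mul, hstep]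
      congr 3
      have h1 : f^[visitTime f A x] x ∈ A := Nat.sInf_mem hv
      have h0 : 1 ≤ visitTime f A x := by
        by_contra h0
        obtain h0 : visitTime f A x = 0 := by omega
        rw [h0] at h1
        exact hxA h1
      have h2 : 1 ≤ returnTime f A x ∧ f^[returnTime f A x] x ∈ A :=
        Nat.sInf_mem (s := {n | 1 ≤ n ∧ f^[n] x ∈ A}) ⟨_, h0, h1⟩
      exact le_antisymm (Nat.sInf_le ⟨h0, h1⟩) (Nat.sInf_le h2.2)
  · intro x
    have h0 : visitTime f A (x : α) = 0 := Nat.le_zero.1 (Nat.sInf_le x.2)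
    simp only [h0, Function.iterate_zero, id, hG'A]

open Classical in
/-- If the cocycle equation over `f` has only constant solutions, the induced map is weakly
mixing. -/
lemma isWeaklyMixing_inducedMap [IsFiniteMeasure μ] (hf : MeasurePreserving f μ μ)
    (hemb : MeasurableEmbedding f) (hA : MeasurableSet A)
    (hvisit : ∀ᵐ x ∂μ, ∃ n, f^[n] x ∈ A)
    (hconst : ∀ (θ : ℂ) (F : α → ℂ), Measurable F →
      (∀ᵐ x ∂μ, F (f x) = (if x ∈ A then θ else 1) * F x) → ∃ d : ℂ, ∀ᵐ x ∂μ, F x = d) :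
    IsWeaklyMixing (inducedMap f A) (μ.comap (Subtype.val : A → α)) := by
  have heigen : ∀ (θ : ℂ) (G : A → ℂ), Measurable G →
      (∀ᵐ x ∂(μ.comap (Subtype.val : A → α)), G (inducedMap f A x) = θ * G x) →
      ∃ d : ℂ, ∀ᵐ x ∂(μ.comap (Subtype.val : A → α)), G x = d := by
    intro θ G hG hGT
    obtain ⟨F, hF, hFf, hFG⟩ := exists_cocycle_of_eigenfunction hf hA hvisit hG hGT
    obtain ⟨d, hd⟩ := hconst θ F hF hFf
    refine ⟨d, (ae_comap_val_iff hA).2 ?_⟩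
    filter_upwards [hd] with x hx hxA
    rw [← hFG ⟨x, hxA⟩, hx]
  refine ⟨⟨measurePreserving_inducedMap hf hemb hA, ⟨fun S hS hinv => ?_⟩⟩, heigen⟩
  obtain ⟨d, hd⟩ := heigen 1 (S.indicator 1) (measurable_one.indicator hS)
    (Eventually.of_forall fun x => by
      have h1 : inducedMap f A x ∈ S ↔ x ∈ S := by
        conv_rhs => rw [← hinv]
        rfl
      by_cases hx : x ∈ S
      · rw [indicator_of_mem hx, indicator_of_mem (h1.2 hx)]
        simp
      · rw [indicator_of_notMem hx, indicator_of_notMem (fun h => hx (h1.1 h))]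
        simp)
  rw [eventuallyConst_set]
  by_cases hd1 : d = 1
  · left
    filter_upwards [hd] with x hx
    by_contra hxS
    rw [indicator_of_notMem hxS, hd1] at hx
    exact zero_ne_one hx
  · right
    filter_upwards [hd] with x hx hxS
    rw [indicator_of_mem hxS] at hx
    exact hd1 hx.symm

end Induced

end IET

theorem theorem4 (b : ℝ) (hb : 0 < b) (f : Equiv.Perm (IET.Space b))
    (hf : IET.IsIET f) (hmin : IET.IsMinimal f)
    (μ : Measure (IET.Space b)) (hprob : IsProbabilityMeasure μ) (hμ : Ergodic f μ) :
    IET.weaklyMixingSet f μ ∈ residual (IET.Space b) ∧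
      NullMeasurableSet (IET.weaklyMixingSet f μ) μ ∧
      μ (IET.weaklyMixingSet f μ) = 1 := by
  classical
  have hmp := hμ.toMeasurePreserving
  obtain ⟨c, hc, hsplit⟩ := IET.exists_le_measureReal_splitSet hb hf hmin hμ
  have hsub : IET.deepSplitSet f μ (c / 2) ⊆ IET.weaklyMixingSet f μ := by
    intro t ht
    have h0 : 0 < (t : ℝ) :=
      IET.pos_of_mem_splitSet (IET.mem_splitSet_of_mem_deepSplitSet one_pos ht)
    have hpos : 0 < μ (Iio t) := hmin.measure_pos hmp isOpen_Iio
      ⟨⟨0, le_rfl, h0.trans t.2.2⟩, mem_Iio.2 (Subtype.coe_lt_coe.1 h0)⟩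
    refine ⟨h0, IET.isWeaklyMixing_inducedMap hmp (IET.measurableEmbedding_iterate hmp.measurable 1)
      measurableSet_Iio (IET.ae_exists_iterate_mem hμ measurableSet_Iio hpos.ne') ?_⟩
    intro θ F hF hFf
    refine IET.ae_eq_const_of_cocycle hmin hμ (half_pos hc) ht hF (θ := θ) ?_
    filter_upwards [hFf] with x hx
    rw [hx]
    rfl
  have hae : ∀ᵐ t ∂μ, t ∈ IET.weaklyMixingSet f μ := by
    filter_upwards [IET.ae_mem_deepSplitSet hμ hc hsplit] with t ht using hsub ht
  have huniv : IET.weaklyMixingSet f μ =ᵐ[μ] univ := eventuallyEq_univ.2 hae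
  refine ⟨?_, ?_, ?_⟩
  · refine mem_of_superset ?_ hsub
    refine countable_iInter_mem.2 fun n => ?_
    exact residual_of_dense_open (IET.isOpen_splitSet _ _)
      (IET.dense_splitSet hmin hc hsplit (by positivity))
  · exact MeasurableSet.univ.nullMeasurableSet.congr huniv.symm
  · rw [measure_congr huniv, measure_univ]
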